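/- **Definitions.** A signature $\Sigma$ is a set of symbols $\alpha$, each with an arity $\sigma(\alpha)\in\mathbb N$ and a coarity $\tau(\alpha)\in\mathbb N$. A *net* $N:m\to n$ consists of a finite set $P$ of ports, a finite set $O$ of operators, a labelling $\lambda:O\to\Sigma$, a source function $s:\{(x,i)\mid x\in O,\ 0\le i<\sigma(\lambda(x))\}\uplus\{0,\dots,n-1\}\to P$ and an injective target function $t:\{(x,i)\mid x\in O,\ 0\le i<\tau(\lambda(x))\}\uplus\{0,\dots,m-1\}\to P$. Isomorphisms of nets are pairs of bijections on ports and operators compatible with $\lambda,s,t$. - *Identity* on $n$: $P=\{0,\dots,n-1\}$, $O=\emptyset$, $s=t=\mathrm{id}$. The symmetry $\gamma_{m,n}:m+n\to n+m$ has $O=\emptyset$, $P=\{0,\dots,m+n-1\}$, $t=\mathrm{id}$, $s(k)=m+k$ for $k<n$ and $s(n+k)=k$ for $k<m$. - *Composite* $N\circ M$ of $M:n_1\to n_2$ and $N:n_2\to n_3$: disjoint union, with $s_M(k)$ identified with $t_N(k)$ for $k<n_2$. *Tensor product* $M\otimes N$: disjoint union, with the inputs and outputs of $M$ numbered before those of $N$.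 - *Trace* of $N:n_1+n\to n_2+n$: the net $\mathrm{Tr}^{n}_{n_1,n_2}(N):n_1\to n_2$ with the operators and labels of $N$, with ports $P_N/{\sim}$ where $\sim$ is the smallest equivalence relation such that $s_N(n_2+k)\sim t_N(n_1+k)$ for all $k<n$, and with source and target functions induced by those of $N$ (without its last $n$ outputs and last $n$ inputs). $\mathbf{Net}_\Sigma$ is the symmetric strict monoidal category with natural numbers as objects, isomorphism classes of nets as morphisms, $m\otimes n=m+n$, and unit $0$. A net *se-rewrites* to another one either by *sharing* (given operators $x,y$ with $\lambda(x)=\lambda(y)$ and $s(x,i)=s(y,i)$ for all $i$, identify $x$ with $y$ and $t(x,i)$ with $t(y,i)$ for all $i$) or by *erasing* (given an operator $x$ such that no $t(x,i)$ is in the image of $s$, remove $x$ and all the ports $t(x,i)$); *se-equivalence* is the generated equivalence relation, and $\mathbf{sNet}_\Sigma$ is the symmetric monoidal category obtained from $\mathbf{Net}_\Sigma$ by quotienting morphisms by se-equivalence. A *trace* on a symmetric monoidal category $\mathcal C$ is a family of functions $\mathrm{Tr}^X_{A,B}:\mathcal C(A\otimes X,B\otimes X)\to\mathcal C(A,B)$,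 natural in $A$ and $B$ and dinatural in $X$ (that is, $\mathrm{Tr}^X_{A,B}((B\otimes g)\circ f)=\mathrm{Tr}^Y_{A,B}(f\circ(A\otimes g))$ for $f:A\otimes X\to B\otimes Y$, $g:Y\to X$), satisfying, up to the coherence isomorphisms, - vanishing: $\mathrm{Tr}^{I}_{A,B}(f)=f$ and $\mathrm{Tr}^{X\otimes Y}_{A,B}(f)=\mathrm{Tr}^X_{A,B}(\mathrm{Tr}^Y_{A\otimes X,B\otimes X}(f))$; - superposing: $g\otimes\mathrm{Tr}^X_{A,B}(f)=\mathrm{Tr}^X_{C\otimes A,D\otimes B}(g\otimes f)$ for $g:C\to D$; - yanking: $\mathrm{Tr}^X_{X,X}(\gamma_{X,X})=\mathrm{id}_X$. **Proposition.** For every signature $\Sigma$, the trace construction on nets induces a trace on $\mathbf{Net}_\Sigma$ and a trace on $\mathbf{sNet}_\Sigma$: in each of the two categories there is a trace whose value on the class of every net $N:n_1+n\to n_2+n$ is the class of the net $\mathrm{Tr}^n_{n_1,n_2}(N)$. -/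

import Mathlib

open CategoryTheory MonoidalCategory

universe u v w

namespace ProcessNet

/-- A signature: a set of symbols, each with an arity (number of inputs) and a coarity
(number of outputs). -/
structure Signature where
  Symbol : Type u
  arity : Symbol → ℕ
  coarity : Symbol → ℕ

/-- A net from `m` to `n` over `S`.  The source function `(x, i) ↦ opSrc x i`, `k ↦ out k` is
defined on inputs of operators and on the `n` outputs of the net; the target function
`(x, i) ↦ opTgt x i`, `k ↦ inp k` is defined on outputs of operators and on the `m` inputs
of the net, and is injective. -/
structure Net (S : Signature.{u}) (m n : ℕ) where
  Port : Type
  Op : Type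
  finite_port : Finite Port
  finite_op : Finite Op
  label : Op → S.Symbol
  opSrc : (x : Op) → Fin (S.arity (label x)) → Port
  out : Fin n → Port
  opTgt : (x : Op) → Fin (S.coarity (label x)) → Port
  inp : Fin m → Port
  tgt_injective : Function.Injective
    (Sum.elim (fun z : (x : Op) × Fin (S.coarity (label x)) => opTgt z.1 z.2) inp)

namespace Net

variable {S : Signature.{u}}

/-- Morphisms of nets with the same source and target. -/
structure Mor {m n : ℕ} (M N : Net S m n) where
  onPort : M.Port → N.Port
  onOp : M.Op → N.Op
  label_eq : ∀ x, N.label (onOp x) = M.label x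
  opSrc_eq : ∀ x i, onPort (M.opSrc x i) =
    N.opSrc (onOp x) (Fin.cast (congrArg S.arity (label_eq x).symm) i)
  out_eq : ∀ k, onPort (M.out k) = N.out k
  opTgt_eq : ∀ x i, onPort (M.opTgt x i) =
    N.opTgt (onOp x) (Fin.cast (congrArg S.coarity (label_eq x).symm) i)
  inp_eq : ∀ k, onPort (M.inp k) = N.inp k

/-- `M ≈ N`: there is an invertible morphism, that is, one which is bijective on ports and on
operators. -/
def Isomorphic {m n : ℕ} (M N : Net S m n) : Prop :=
  ∃ φ : Mor M N, Function.Bijective φ.onPort ∧ Function.Bijective φ.onOp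

theorem opSrc_congr {m n : ℕ} (N : Net S m n) {x y : N.Op} (h : x = y)
    {i : Fin (S.arity (N.label x))} {j : Fin (S.arity (N.label y))} (hij : (i : ℕ) = j) :
    N.opSrc x i = N.opSrc y j := by
  subst h; congr 1; exact Fin.ext hij

theorem opTgt_congr {m n : ℕ} (N : Net S m n) {x y : N.Op} (h : x = y)
    {i : Fin (S.coarity (N.label x))} {j : Fin (S.coarity (N.label y))} (hij : (i : ℕ) = j) :
    N.opTgt x i = N.opTgt y j := by
  subst h; congr 1; exact Fin.ext hij

theorem inp_injective {m n : ℕ} (N : Net S m n) : Function.Injective N.inp := fun i j h =>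
  Sum.inr_injective (N.tgt_injective (a₁ := Sum.inr i) (a₂ := Sum.inr j) h)

theorem opTgt_ne_inp {m n : ℕ} (N : Net S m n) (x i k) : N.opTgt x i ≠ N.inp k := fun h =>
  Sum.inl_ne_inr (N.tgt_injective (a₁ := Sum.inl ⟨x, i⟩) (a₂ := Sum.inr k) h)

theorem sigma_eq_of_opTgt {m n : ℕ} (N : Net S m n) {x y i j}
    (h : N.opTgt x i = N.opTgt y j) :
    (⟨x, i⟩ : (x : N.Op) × Fin (S.coarity (N.label x))) = ⟨y, j⟩ :=
  Sum.inl_injective (N.tgt_injective (a₁ := Sum.inl ⟨x, i⟩) (a₂ := Sum.inl ⟨y, j⟩) h)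

theorem Isomorphic.refl {m n : ℕ} (M : Net S m n) : Isomorphic M M :=
  ⟨⟨id, id, fun _ => rfl, fun _ _ => rfl, fun _ => rfl, fun _ _ => rfl, fun _ => rfl⟩,
    Function.bijective_id, Function.bijective_id⟩

theorem Isomorphic.symm {m n : ℕ} {M N : Net S m n} (h : Isomorphic M N) : Isomorphic N M := by
  obtain ⟨φ, hP, hO⟩ := h
  let eP := Equiv.ofBijective _ hP
  let eO := Equiv.ofBijective _ hO
  have hl : ∀ x, M.label (eO.symm x) = N.label x := fun x => by
    rw [← φ.label_eq]; exact congrArg N.label (eO.apply_symm_apply x)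
  refine ⟨⟨eP.symm, eO.symm, hl, fun x i => ?_, fun k => ?_, fun x i => ?_, fun k => ?_⟩,
    eP.symm.bijective, eO.symm.bijective⟩
  · rw [Equiv.symm_apply_eq]
    refine Eq.trans ?_ (φ.opSrc_eq _ _).symm
    exact opSrc_congr N (eO.apply_symm_apply x).symm rfl
  · rw [Equiv.symm_apply_eq]; exact (φ.out_eq k).symm
  · rw [Equiv.symm_apply_eq]
    refine Eq.trans ?_ (φ.opTgt_eq _ _).symm
    exact opTgt_congr N (eO.apply_symm_apply x).symm rfl
  · rw [Equiv.symm_apply_eq]; exact (φ.inp_eq k).symm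

theorem Isomorphic.trans {m n : ℕ} {M N K : Net S m n} (h : Isomorphic M N)
    (h' : Isomorphic N K) : Isomorphic M K := by
  obtain ⟨φ, hP, hO⟩ := h
  obtain ⟨ψ, hP', hO'⟩ := h'
  refine ⟨⟨ψ.onPort ∘ φ.onPort, ψ.onOp ∘ φ.onOp, fun x => ?_, fun x i => ?_, fun k => ?_,
    fun x i => ?_, fun k => ?_⟩, hP'.comp hP, hO'.comp hO⟩
  · exact (ψ.label_eq _).trans (φ.label_eq x)
  · simp [φ.opSrc_eq, ψ.opSrc_eq]
  · simp [φ.out_eq, ψ.out_eq]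
  · simp [φ.opTgt_eq, ψ.opTgt_eq]
  · simp [φ.inp_eq, ψ.inp_eq]

/-- Isomorphism of nets, as an equivalence relation. -/
def isoSetoid (S : Signature.{u}) (m n : ℕ) : Setoid (Net S m n) :=
  ⟨Isomorphic, Isomorphic.refl, Isomorphic.symm, Isomorphic.trans⟩

/-- The net without operators whose wires realise a bijection: the `k`-th output is connected
to the `e k`-th input. -/
def perm {m n : ℕ} (e : Fin n ≃ Fin m) : Net S m n where
  Port := Fin m
  Op := Empty
  finite_port := inferInstance
  finite_op := inferInstance
  label := Empty.elim
  opSrc x := x.elim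
  out := e
  opTgt x := x.elim
  inp := fun k => k
  tgt_injective := by
    rintro (⟨x, -⟩ | i) (⟨y, -⟩ | j) h
    · exact x.elim
    · exact x.elim
    · exact y.elim
    · exact congrArg Sum.inr h

/-- The identity net. -/
protected def id (n : ℕ) : Net S n n := perm (Equiv.refl (Fin n))

/-- The identification of ports in a composite: `s_M(k)` with `t_N(k)`. -/
def compRel {n₁ n₂ n₃ : ℕ} (M : Net S n₁ n₂) (N : Net S n₂ n₃)
    (p q : M.Port ⊕ N.Port) : Prop :=
  ∃ k : Fin n₂, p = Sum.inl (M.out k) ∧ q = Sum.inr (N.inp k)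

open Classical in
/-- A canonical representative of a port in a composite. -/
noncomputable def compRep {n₁ n₂ n₃ : ℕ} (M : Net S n₁ n₂) (N : Net S n₂ n₃) :
    Quot (compRel M N) → M.Port ⊕ N.Port :=
  Quot.lift (Sum.elim Sum.inl fun q =>
      if h : ∃ k, N.inp k = q then Sum.inl (M.out h.choose) else Sum.inr q) <| by
    rintro _ _ ⟨k, rfl, rfl⟩
    have h : ∃ k', N.inp k' = N.inp k := ⟨k, rfl⟩
    simp only [Sum.elim_inl, Sum.elim_inr, dif_pos h]
    rw [N.inp_injective h.choose_spec]

theorem compRep_inl {n₁ n₂ n₃ : ℕ} (M : Net S n₁ n₂) (N : Net S n₂ n₃) (p : M.Port) :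
    compRep M N (Quot.mk _ (Sum.inl p)) = Sum.inl p := rfl

theorem compRep_inr {n₁ n₂ n₃ : ℕ} (M : Net S n₁ n₂) (N : Net S n₂ n₃) (q : N.Port)
    (h : ∀ k, N.inp k ≠ q) : compRep M N (Quot.mk _ (Sum.inr q)) = Sum.inr q := by
  have : ¬ ∃ k, N.inp k = q := fun ⟨k, hk⟩ => h k hk
  simp [compRep, this]

theorem comp_inl_inj {n₁ n₂ n₃ : ℕ} (M : Net S n₁ n₂) (N : Net S n₂ n₃) {p p' : M.Port}
    (h : Quot.mk (compRel M N) (Sum.inl p) = Quot.mk (compRel M N) (Sum.inl p')) : p = p' :=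
  Sum.inl_injective (congrArg (compRep M N) h)

theorem comp_inr_inj {n₁ n₂ n₃ : ℕ} (M : Net S n₁ n₂) (N : Net S n₂ n₃) {q q' : N.Port}
    (hq : ∀ k, N.inp k ≠ q) (hq' : ∀ k, N.inp k ≠ q')
    (h : Quot.mk (compRel M N) (Sum.inr q) = Quot.mk (compRel M N) (Sum.inr q')) : q = q' :=
  Sum.inr_injective ((compRep_inr M N q hq).symm.trans
    ((congrArg (compRep M N) h).trans (compRep_inr M N q' hq')))

theorem comp_inl_eq_inr {n₁ n₂ n₃ : ℕ} (M : Net S n₁ n₂) (N : Net S n₂ n₃) {p : M.Port}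
    {q : N.Port} (h : Quot.mk (compRel M N) (Sum.inl p) = Quot.mk (compRel M N) (Sum.inr q)) :
    ∃ k, M.out k = p ∧ N.inp k = q := by
  by_cases hq : ∃ k, N.inp k = q
  · obtain ⟨k, rfl⟩ := hq
    refine ⟨k, ?_, rfl⟩
    refine (comp_inl_inj M N (h.trans ?_)).symm
    exact (Quot.sound ⟨k, rfl, rfl⟩).symm
  · exact absurd ((congrArg (compRep M N) h).trans
      (compRep_inr M N q fun k hk => hq ⟨k, hk⟩)) Sum.inl_ne_inr

/-- Composition of nets, in diagrammatic order: first `M`, then `N`. -/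
def comp {n₁ n₂ n₃ : ℕ} (M : Net S n₁ n₂) (N : Net S n₂ n₃) : Net S n₁ n₃ where
  Port := Quot (compRel M N)
  Op := M.Op ⊕ N.Op
  finite_port := by
    have := M.finite_port
    have := N.finite_port
    exact Finite.of_surjective (Quot.mk _) Quot.mk_surjective
  finite_op := by
    have := M.finite_op
    have := N.finite_op
    infer_instance
  label := Sum.elim M.label N.label
  opSrc
    | Sum.inl x, i => Quot.mk _ (Sum.inl (M.opSrc x i))
    | Sum.inr x, i => Quot.mk _ (Sum.inr (N.opSrc x i))
  out k := Quot.mk _ (Sum.inr (N.out k))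
  opTgt
    | Sum.inl x, i => Quot.mk _ (Sum.inl (M.opTgt x i))
    | Sum.inr x, i => Quot.mk _ (Sum.inr (N.opTgt x i))
  inp k := Quot.mk _ (Sum.inl (M.inp k))
  tgt_injective := by
    have hN : ∀ (x i) (k : Fin n₂), N.inp k ≠ N.opTgt x i := fun x i k =>
      (N.opTgt_ne_inp x i k).symm
    rintro (⟨x | x, i⟩ | i) (⟨y | y, j⟩ | j) h
    · cases M.sigma_eq_of_opTgt (comp_inl_inj M N h); rfl
    · obtain ⟨k, -, hk⟩ := comp_inl_eq_inr M N h
      exact absurd hk (hN _ _ _)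
    · exact absurd (comp_inl_inj M N h) (M.opTgt_ne_inp _ _ _)
    · obtain ⟨k, -, hk⟩ := comp_inl_eq_inr M N h.symm
      exact absurd hk (hN _ _ _)
    · cases N.sigma_eq_of_opTgt (comp_inr_inj M N (hN _ _) (hN _ _) h); rfl
    · obtain ⟨k, -, hk⟩ := comp_inl_eq_inr M N h.symm
      exact absurd hk (hN _ _ _)
    · exact absurd (comp_inl_inj M N h).symm (M.opTgt_ne_inp _ _ _)
    · obtain ⟨k, -, hk⟩ := comp_inl_eq_inr M N h
      exact absurd hk (hN _ _ _)
    · rw [M.inp_injective (comp_inl_inj M N h)]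

/-- Tensor product of nets. -/
def tensor {m m' n n' : ℕ} (M : Net S m m') (N : Net S n n') : Net S (m + n) (m' + n') where
  Port := M.Port ⊕ N.Port
  Op := M.Op ⊕ N.Op
  finite_port := by
    have := M.finite_port
    have := N.finite_port
    infer_instance
  finite_op := by
    have := M.finite_op
    have := N.finite_op
    infer_instance
  label := Sum.elim M.label N.label
  opSrc
    | Sum.inl x, i => Sum.inl (M.opSrc x i)
    | Sum.inr x, i => Sum.inr (N.opSrc x i)
  out := Fin.append (fun k => Sum.inl (M.out k)) (fun k => Sum.inr (N.out k))
  opTgt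
    | Sum.inl x, i => Sum.inl (M.opTgt x i)
    | Sum.inr x, i => Sum.inr (N.opTgt x i)
  inp := Fin.append (fun k => Sum.inl (M.inp k)) (fun k => Sum.inr (N.inp k))
  tgt_injective := by
    rintro (⟨x | x, i⟩ | i) (⟨y | y, j⟩ | j) h <;>
      (try induction i using Fin.addCases) <;> (try induction j using Fin.addCases) <;>
      simp only [Sum.elim_inl, Sum.elim_inr, Fin.append_left, Fin.append_right,
        reduceCtorEq, Sum.inl.injEq, Sum.inr.injEq] at h
    · cases M.sigma_eq_of_opTgt h; rfl
    · exact absurd h (M.opTgt_ne_inp _ _ _)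
    · cases N.sigma_eq_of_opTgt h; rfl
    · exact absurd h (N.opTgt_ne_inp _ _ _)
    · exact absurd h.symm (M.opTgt_ne_inp _ _ _)
    · exact absurd h.symm (N.opTgt_ne_inp _ _ _)
    · rw [M.inp_injective h]
    · rw [N.inp_injective h]

/-- The identification of ports in a trace: the source of each of the last `n` outputs with
the target of the corresponding one of the last `n` inputs. -/
def traceRel {n₁ n₂ n : ℕ} (N : Net S (n₁ + n) (n₂ + n)) (p q : N.Port) : Prop :=
  ∃ k : Fin n, p = N.out (Fin.natAdd n₂ k) ∧ q = N.inp (Fin.natAdd n₁ k)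

/-- A port which is not the target of one of the last `n` inputs is not identified with any
other such port. -/
theorem traceRel_sink {n₁ n₂ n : ℕ} (N : Net S (n₁ + n) (n₂ + n)) {p q : N.Port}
    (hp : ∀ k : Fin n, N.inp (Fin.natAdd n₁ k) ≠ p) (hq : ∀ k : Fin n, N.inp (Fin.natAdd n₁ k) ≠ q)
    (h : Quot.mk (traceRel N) p = Quot.mk (traceRel N) q) : p = q := by
  classical
  let step : N.Port → N.Port := fun r =>
    if h : ∃ k : Fin n, N.inp (Fin.natAdd n₁ k) = r then N.out (Fin.natAdd n₂ h.choose) else r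
  have step_inp : ∀ k : Fin n, step (N.inp (Fin.natAdd n₁ k)) = N.out (Fin.natAdd n₂ k) := by
    intro k
    have h : ∃ k' : Fin n, N.inp (Fin.natAdd n₁ k') = N.inp (Fin.natAdd n₁ k) := ⟨k, rfl⟩
    have h2 : h.choose = k := (Fin.natAdd_injective n n₁) (N.inp_injective h.choose_spec)
    simp only [step, dif_pos h, h2]
  have step_sink : ∀ r, (∀ k : Fin n, N.inp (Fin.natAdd n₁ k) ≠ r) → step r = r := by
    intro r hr
    have : ¬ ∃ k : Fin n, N.inp (Fin.natAdd n₁ k) = r := fun ⟨k, hk⟩ => hr k hk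
    simp only [step, dif_neg this]
  have iter : ∀ r, step r = r → ∀ a, step^[a] r = r := fun r hr a => Function.iterate_fixed hr a
  let D : Quot (traceRel N) → Prop := Quot.lift (fun r => ∃ a, step^[a] r = p) <| by
    rintro _ _ ⟨k, rfl, rfl⟩
    refine propext ⟨fun ⟨a, ha⟩ => ⟨a + 1, ?_⟩, fun ⟨a, ha⟩ => ⟨a, ?_⟩⟩
    · rw [Function.iterate_succ_apply, step_inp, ha]
    · rw [← step_inp, ← Function.iterate_succ_apply, Function.iterate_succ_apply', ha,
        step_sink p hp]
  have hD : D (Quot.mk _ p) := ⟨0, rfl⟩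
  rw [h] at hD
  obtain ⟨a, ha⟩ := hD
  exact (ha.symm.trans (iter q (step_sink q hq) a))

/-- The trace of a net `N` from `n₁ + n` to `n₂ + n`: the last `n` outputs are fed back into the
last `n` inputs. -/
def trace {n₁ n₂ n : ℕ} (N : Net S (n₁ + n) (n₂ + n)) : Net S n₁ n₂ where
  Port := Quot (traceRel N)
  Op := N.Op
  finite_port := by
    have := N.finite_port
    exact Finite.of_surjective (Quot.mk _) Quot.mk_surjective
  finite_op := N.finite_op
  label := N.label
  opSrc x i := Quot.mk _ (N.opSrc x i)
  out k := Quot.mk _ (N.out (Fin.castAdd n k))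
  opTgt x i := Quot.mk _ (N.opTgt x i)
  inp k := Quot.mk _ (N.inp (Fin.castAdd n k))
  tgt_injective := by
    have h₁ : ∀ (x i) (k : Fin n), N.inp (Fin.natAdd n₁ k) ≠ N.opTgt x i :=
      fun x i k => (N.opTgt_ne_inp x i _).symm
    have h₂ : ∀ (i : Fin n₁) (k : Fin n), N.inp (Fin.natAdd n₁ k) ≠ N.inp (Fin.castAdd n i) := by
      intro i k h
      have := congrArg Fin.val (N.inp_injective h)
      simp only [Fin.val_natAdd, Fin.val_castAdd] at this
      omega
    rintro (⟨x, i⟩ | i) (⟨y, j⟩ | j) h <;> simp only [Sum.elim_inl, Sum.elim_inr] at h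
    · have := N.sigma_eq_of_opTgt (traceRel_sink N (h₁ x i) (h₁ y j) h)
      rw [this]
    · exact absurd (traceRel_sink N (h₁ x i) (h₂ j) h) (N.opTgt_ne_inp _ _ _)
    · exact absurd (traceRel_sink N (h₂ i) (h₁ y j) h).symm (N.opTgt_ne_inp _ _ _)
    · rw [(Fin.castAdd_injective n₁ n) (N.inp_injective (traceRel_sink N (h₂ i) (h₂ j) h))]

@[simp] theorem tensor_out_left {m m' n n' : ℕ} (M : Net S m m') (N : Net S n n') (k : Fin m') :
    (tensor M N).out (Fin.castAdd n' k) = Sum.inl (M.out k) :=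
  Fin.append_left (fun k => Sum.inl (M.out k)) (fun k => Sum.inr (N.out k)) k

@[simp] theorem tensor_out_right {m m' n n' : ℕ} (M : Net S m m') (N : Net S n n') (k : Fin n') :
    (tensor M N).out (Fin.natAdd m' k) = Sum.inr (N.out k) :=
  Fin.append_right (fun k => Sum.inl (M.out k)) (fun k => Sum.inr (N.out k)) k

@[simp] theorem tensor_inp_left {m m' n n' : ℕ} (M : Net S m m') (N : Net S n n') (k : Fin m) :
    (tensor M N).inp (Fin.castAdd n k) = Sum.inl (M.inp k) :=
  Fin.append_left (fun k => Sum.inl (M.inp k)) (fun k => Sum.inr (N.inp k)) k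

@[simp] theorem tensor_inp_right {m m' n n' : ℕ} (M : Net S m m') (N : Net S n n') (k : Fin n) :
    (tensor M N).inp (Fin.natAdd m k) = Sum.inr (N.inp k) :=
  Fin.append_right (fun k => Sum.inl (M.inp k)) (fun k => Sum.inr (N.inp k)) k

/-! ### Functoriality of the constructions with respect to morphisms of nets -/

theorem comp_sound {n₁ n₂ n₃ : ℕ} (M : Net S n₁ n₂) (N : Net S n₂ n₃) (k : Fin n₂) :
    Quot.mk (compRel M N) (Sum.inl (M.out k)) = Quot.mk (compRel M N) (Sum.inr (N.inp k)) :=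
  Quot.sound ⟨k, rfl, rfl⟩

/-- Every port of a composite comes from the first net, or from a port of the second net which
is not the target of an input. -/
theorem comp_port_cases {n₁ n₂ n₃ : ℕ} (M : Net S n₁ n₂) (N : Net S n₂ n₃)
    (c : Quot (compRel M N)) : (∃ p, c = Quot.mk _ (Sum.inl p)) ∨
      ∃ q, (∀ k, N.inp k ≠ q) ∧ c = Quot.mk _ (Sum.inr q) := by
  induction c using Quot.ind with
  | mk c =>
    rcases c with p | q
    · exact Or.inl ⟨p, rfl⟩
    · by_cases h : ∃ k, N.inp k = q
      · obtain ⟨k, rfl⟩ := h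
        exact Or.inl ⟨_, (comp_sound M N k).symm⟩
      · exact Or.inr ⟨q, fun k hk => h ⟨k, hk⟩, rfl⟩

/-- The identity morphism of a net. -/
def Mor.refl {m n : ℕ} (M : Net S m n) : Mor M M :=
  ⟨id, id, fun _ => rfl, fun _ _ => rfl, fun _ => rfl, fun _ _ => rfl, fun _ => rfl⟩

/-- Composition of nets is functorial with respect to morphisms of nets. -/
def compMap {n₁ n₂ n₃ : ℕ} {M M' : Net S n₁ n₂} {N N' : Net S n₂ n₃} (φ : Mor M M')
    (ψ : Mor N N') : Mor (comp M N) (comp M' N') where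
  onPort := Quot.map (Sum.map φ.onPort ψ.onPort) <| by
    rintro _ _ ⟨k, rfl, rfl⟩
    exact ⟨k, congrArg Sum.inl (φ.out_eq k), congrArg Sum.inr (ψ.inp_eq k)⟩
  onOp := Sum.map φ.onOp ψ.onOp
  label_eq := by
    rintro (x | x)
    · exact φ.label_eq x
    · exact ψ.label_eq x
  opSrc_eq := by
    rintro (x | x) i
    · exact congrArg (fun p => Quot.mk _ (Sum.inl p)) (φ.opSrc_eq x i)
    · exact congrArg (fun p => Quot.mk _ (Sum.inr p)) (ψ.opSrc_eq x i)
  out_eq k := congrArg (fun p => Quot.mk _ (Sum.inr p)) (ψ.out_eq k)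
  opTgt_eq := by
    rintro (x | x) i
    · exact congrArg (fun p => Quot.mk _ (Sum.inl p)) (φ.opTgt_eq x i)
    · exact congrArg (fun p => Quot.mk _ (Sum.inr p)) (ψ.opTgt_eq x i)
  inp_eq k := congrArg (fun p => Quot.mk _ (Sum.inl p)) (φ.inp_eq k)

theorem compMap_injective {n₁ n₂ n₃ : ℕ} {M M' : Net S n₁ n₂} {N N' : Net S n₂ n₃}
    (φ : Mor M M') (ψ : Mor N N') (hφ : Function.Injective φ.onPort)
    (hψ : Function.Injective ψ.onPort) : Function.Injective (compMap φ ψ).onPort := by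
  have mixed : ∀ p q, (compMap φ ψ).onPort (Quot.mk _ (Sum.inl p)) =
      (compMap φ ψ).onPort (Quot.mk _ (Sum.inr q)) →
      Quot.mk (compRel M N) (Sum.inl p) = Quot.mk _ (Sum.inr q) := by
    intro p q h
    obtain ⟨k, h1, h2⟩ := comp_inl_eq_inr M' N' h
    rw [← φ.out_eq] at h1
    rw [← ψ.inp_eq] at h2
    rw [← hφ h1, ← hψ h2]
    exact comp_sound M N k
  intro c d h
  rcases comp_port_cases M N c with ⟨p, rfl⟩ | ⟨q, hq, rfl⟩ <;>
    rcases comp_port_cases M N d with ⟨p', rfl⟩ | ⟨q', hq', rfl⟩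
  · rw [hφ (comp_inl_inj M' N' h)]
  · exact mixed _ _ h
  · exact (mixed _ _ h.symm).symm
  · have h1 : ∀ q, (∀ k, N.inp k ≠ q) → ∀ k, N'.inp k ≠ ψ.onPort q := fun q hq k hk =>
      hq k (hψ ((ψ.inp_eq k).trans hk))
    rw [hψ (comp_inr_inj M' N' (h1 q hq) (h1 q' hq') h)]

theorem compMap_surjective {n₁ n₂ n₃ : ℕ} {M M' : Net S n₁ n₂} {N N' : Net S n₂ n₃}
    (φ : Mor M M') (ψ : Mor N N') (hφ : Function.Surjective φ.onPort)
    (hψ : Function.Surjective ψ.onPort) : Function.Surjective (compMap φ ψ).onPort := by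
  intro c
  induction c using Quot.ind with
  | mk c =>
    obtain ⟨d, rfl⟩ := (hφ.sumMap hψ) c
    exact ⟨Quot.mk _ d, rfl⟩

theorem comp_congr {n₁ n₂ n₃ : ℕ} {M M' : Net S n₁ n₂} {N N' : Net S n₂ n₃}
    (hM : Isomorphic M M') (hN : Isomorphic N N') : Isomorphic (comp M N) (comp M' N') := by
  obtain ⟨φ, hφ, hφ'⟩ := hM
  obtain ⟨ψ, hψ, hψ'⟩ := hN
  exact ⟨compMap φ ψ, ⟨compMap_injective φ ψ hφ.1 hψ.1, compMap_surjective φ ψ hφ.2 hψ.2⟩,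
    hφ'.1.sumMap hψ'.1, hφ'.2.sumMap hψ'.2⟩

/-- The tensor product of nets is functorial with respect to morphisms of nets. -/
def tensorMap {m m' n n' : ℕ} {M M' : Net S m m'} {N N' : Net S n n'} (φ : Mor M M')
    (ψ : Mor N N') : Mor (tensor M N) (tensor M' N') where
  onPort := Sum.map φ.onPort ψ.onPort
  onOp := Sum.map φ.onOp ψ.onOp
  label_eq := by
    rintro (x | x)
    · exact φ.label_eq x
    · exact ψ.label_eq x
  opSrc_eq := by
    rintro (x | x) i
    · exact congrArg Sum.inl (φ.opSrc_eq x i)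
    · exact congrArg Sum.inr (ψ.opSrc_eq x i)
  out_eq k := by
    induction k using Fin.addCases <;> simp [φ.out_eq, ψ.out_eq] <;> rfl
  opTgt_eq := by
    rintro (x | x) i
    · exact congrArg Sum.inl (φ.opTgt_eq x i)
    · exact congrArg Sum.inr (ψ.opTgt_eq x i)
  inp_eq k := by
    induction k using Fin.addCases <;> simp [φ.inp_eq, ψ.inp_eq] <;> rfl

theorem tensor_congr {m m' n n' : ℕ} {M M' : Net S m m'} {N N' : Net S n n'}
    (hM : Isomorphic M M') (hN : Isomorphic N N') :
    Isomorphic (tensor M N) (tensor M' N') := by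
  obtain ⟨φ, hφ, hφ'⟩ := hM
  obtain ⟨ψ, hψ, hψ'⟩ := hN
  exact ⟨tensorMap φ ψ, ⟨hφ.1.sumMap hψ.1, hφ.2.sumMap hψ.2⟩,
    hφ'.1.sumMap hψ'.1, hφ'.2.sumMap hψ'.2⟩

/-! ### Isomorphisms between composites and tensor products -/

/-- Renumbering of the inputs and of the outputs of a net. -/
def reindex {m n m' n' : ℕ} (N : Net S m n) (e : Fin m' ≃ Fin m) (f : Fin n' ≃ Fin n) :
    Net S m' n' where
  Port := N.Port
  Op := N.Op
  finite_port := N.finite_port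
  finite_op := N.finite_op
  label := N.label
  opSrc := N.opSrc
  out := N.out ∘ f
  opTgt := N.opTgt
  inp := N.inp ∘ e
  tgt_injective := by
    have : Sum.elim (fun z : (x : N.Op) × Fin (S.coarity (N.label x)) => N.opTgt z.1 z.2)
        (N.inp ∘ e) = Sum.elim (fun z : (x : N.Op) × Fin (S.coarity (N.label x)) =>
          N.opTgt z.1 z.2) N.inp ∘ Sum.map id e := by
      funext z; rcases z with z | z <;> rfl
    rw [this]
    exact N.tgt_injective.comp (Function.injective_id.sumMap e.injective)

theorem comp_perm {m n n' : ℕ} (N : Net S m n) (f : Fin n' ≃ Fin n) :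
    Isomorphic (N.reindex (Equiv.refl _) f) (comp N (perm f)) := by
  refine ⟨⟨fun p => Quot.mk _ (Sum.inl p), Sum.inl, fun _ => rfl, fun _ _ => rfl,
    fun k => comp_sound N (perm f) (f k), fun _ _ => rfl, fun _ => rfl⟩,
    ⟨fun p q h => comp_inl_inj N (perm f) h, fun c => ?_⟩, Sum.inl_injective, ?_⟩
  · rcases comp_port_cases _ _ c with ⟨p, rfl⟩ | ⟨q, hq, rfl⟩
    · exact ⟨p, rfl⟩
    · exact absurd rfl (hq q)
  · rintro (x | x)
    · exact ⟨x, rfl⟩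
    · exact Empty.elim x

theorem perm_comp {m n n' : ℕ} (e : Fin n ≃ Fin m) (N : Net S n n') :
    Isomorphic (N.reindex e.symm (Equiv.refl _)) (comp (perm e) N) := by
  refine ⟨⟨fun p => Quot.mk _ (Sum.inr p), Sum.inr, fun _ => rfl, fun _ _ => rfl,
    fun k => rfl, fun _ _ => rfl, fun k => ?_⟩,
    Function.bijective_iff_has_inverse.2
      ⟨Quot.lift (Sum.elim (fun k => N.inp (e.symm k)) id) ?_, fun p => rfl, fun c => ?_⟩,
    Sum.inr_injective, ?_⟩
  · refine (comp_sound (perm e) N (e.symm k)).symm.trans ?_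
    exact congrArg (fun k => Quot.mk _ (Sum.inl k)) (e.apply_symm_apply k)
  · rintro _ _ ⟨k, rfl, rfl⟩
    exact congrArg N.inp (e.symm_apply_apply k)
  · rcases comp_port_cases _ _ c with ⟨p, rfl⟩ | ⟨q, hq, rfl⟩
    · refine (comp_sound (perm e) N (e.symm p)).symm.trans ?_
      exact congrArg (fun k => Quot.mk _ (Sum.inl k)) (e.apply_symm_apply p)
    · rfl
  · rintro (x | x)
    · exact Empty.elim x
    · exact ⟨x, rfl⟩

theorem comp_assoc {n₁ n₂ n₃ n₄ : ℕ} (M : Net S n₁ n₂) (N : Net S n₂ n₃) (K : Net S n₃ n₄) :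
    Isomorphic (comp (comp M N) K) (comp M (comp N K)) := by
  refine ⟨⟨Quot.lift (Sum.elim (Quot.lift (Sum.elim (fun p => Quot.mk _ (Sum.inl p))
      (fun p => Quot.mk _ (Sum.inr (Quot.mk _ (Sum.inl p))))) ?_)
      (fun p => Quot.mk _ (Sum.inr (Quot.mk _ (Sum.inr p))))) ?_,
    Equiv.sumAssoc _ _ _, ?_, ?_, fun _ => rfl, ?_, fun _ => rfl⟩,
    Function.bijective_iff_has_inverse.2
      ⟨Quot.lift (Sum.elim (fun p => Quot.mk _ (Sum.inl (Quot.mk _ (Sum.inl p))))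
        (Quot.lift (Sum.elim (fun p => Quot.mk _ (Sum.inl (Quot.mk _ (Sum.inr p))))
          (fun p => Quot.mk _ (Sum.inr p))) ?_)) ?_, ?_, ?_⟩, Equiv.bijective _⟩
  · rintro _ _ ⟨k, rfl, rfl⟩
    exact comp_sound M (comp N K) k
  · rintro _ _ ⟨k, rfl, rfl⟩
    exact congrArg (fun p => Quot.mk _ (Sum.inr p)) (comp_sound N K k)
  · rintro ((x | x) | x) <;> rfl
  · rintro ((x | x) | x) i <;> rfl
  · rintro ((x | x) | x) i <;> rfl
  · rintro _ _ ⟨k, rfl, rfl⟩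
    exact comp_sound (comp M N) K k
  · rintro _ _ ⟨k, rfl, rfl⟩
    exact congrArg (fun p => Quot.mk _ (Sum.inl p)) (comp_sound M N k)
  · intro c
    induction c using Quot.ind with
    | mk c =>
      rcases c with c | p
      · induction c using Quot.ind with
        | mk c => rcases c with p | p <;> rfl
      · rfl
  · intro c
    induction c using Quot.ind with
    | mk c =>
      rcases c with p | c
      · rfl
      · induction c using Quot.ind with
        | mk c => rcases c with p | p <;> rfl

theorem tensor_comp {a₁ a₂ a₃ b₁ b₂ b₃ : ℕ} (M : Net S a₁ a₂) (N : Net S a₂ a₃)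
    (M' : Net S b₁ b₂) (N' : Net S b₂ b₃) :
    Isomorphic (comp (tensor M M') (tensor N N')) (tensor (comp M N) (comp M' N')) := by
  refine ⟨⟨Quot.lift (Sum.elim
      (Sum.map (fun p => Quot.mk _ (Sum.inl p)) (fun p => Quot.mk _ (Sum.inl p)))
      (Sum.map (fun p => Quot.mk _ (Sum.inr p)) (fun p => Quot.mk _ (Sum.inr p)))) ?_,
    Equiv.sumSumSumComm _ _ _ _, ?_, ?_, ?_, ?_, ?_⟩,
    Function.bijective_iff_has_inverse.2 ⟨Sum.elim
      (Quot.lift (Sum.elim (fun p => Quot.mk _ (Sum.inl (Sum.inl p)))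
        (fun p => Quot.mk _ (Sum.inr (Sum.inl p)))) ?_)
      (Quot.lift (Sum.elim (fun p => Quot.mk _ (Sum.inl (Sum.inr p)))
        (fun p => Quot.mk _ (Sum.inr (Sum.inr p)))) ?_), ?_, ?_⟩, Equiv.bijective _⟩
  · rintro _ _ ⟨k, rfl, rfl⟩
    induction k using Fin.addCases with
    | left k =>
      rw [tensor_out_left, tensor_inp_left]
      exact congrArg Sum.inl (comp_sound M N k)
    | right k =>
      rw [tensor_out_right, tensor_inp_right]
      exact congrArg Sum.inr (comp_sound M' N' k)
  · rintro ((x | x) | (x | x)) <;> rfl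
  · rintro ((x | x) | (x | x)) i <;> rfl
  · intro k
    induction k using Fin.addCases <;> simp [comp] <;> rfl
  · rintro ((x | x) | (x | x)) i <;> rfl
  · intro k
    induction k using Fin.addCases <;> simp [comp] <;> rfl
  · rintro _ _ ⟨k, rfl, rfl⟩
    have := comp_sound (tensor M M') (tensor N N') (Fin.castAdd b₂ k)
    rwa [tensor_out_left, tensor_inp_left] at this
  · rintro _ _ ⟨k, rfl, rfl⟩
    have := comp_sound (tensor M M') (tensor N N') (Fin.natAdd a₂ k)
    rwa [tensor_out_right, tensor_inp_right] at this
  · rintro ⟨((p | p) | (p | p))⟩ <;> rfl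
  · rintro (c | c) <;> induction c using Quot.ind with
    | mk c => rcases c with p | p <;> rfl

/-- The juxtaposition of two bijections. -/
def permAdd {m n m' n' : ℕ} (e : Fin n ≃ Fin m) (f : Fin n' ≃ Fin m') :
    Fin (n + n') ≃ Fin (m + m') :=
  finSumFinEquiv.symm.trans ((Equiv.sumCongr e f).trans finSumFinEquiv)

@[simp] theorem permAdd_left {m n m' n' : ℕ} (e : Fin n ≃ Fin m) (f : Fin n' ≃ Fin m')
    (k : Fin n) : permAdd e f (Fin.castAdd n' k) = Fin.castAdd m' (e k) := by
  simp [permAdd]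

@[simp] theorem permAdd_right {m n m' n' : ℕ} (e : Fin n ≃ Fin m) (f : Fin n' ≃ Fin m')
    (k : Fin n') : permAdd e f (Fin.natAdd n k) = Fin.natAdd m (f k) := by
  simp [permAdd]

theorem permAdd_finCongr {m n m' n' : ℕ} (h : n = m) (h' : n' = m') :
    permAdd (finCongr h) (finCongr h') = finCongr (by rw [h, h']) := by
  subst h; subst h'
  ext k
  induction k using Fin.addCases <;> simp

theorem tensor_perm {m n m' n' : ℕ} (e : Fin n ≃ Fin m) (f : Fin n' ≃ Fin m') :
    Isomorphic (tensor (perm e : Net S m n) (perm f)) (perm (permAdd e f)) := by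
  refine ⟨⟨finSumFinEquiv, Sum.elim id id, ?_, ?_, ?_, ?_, ?_⟩, Equiv.bijective _, ?_, ?_⟩
  · rintro (x | x) <;> exact Empty.elim x
  · rintro (x | x) <;> exact Empty.elim x
  · intro k
    induction k using Fin.addCases <;> simp [perm]
  · rintro (x | x) <;> exact Empty.elim x
  · intro k
    induction k using Fin.addCases <;> simp [perm]
  · rintro (x | x) <;> exact Empty.elim x
  · intro x; exact Empty.elim x

@[simp] theorem finCongr_castAdd {x y z : ℕ} (h : x + (y + z) = x + y + z) (i : Fin x) :
    Fin.cast h (Fin.castAdd (y + z) i) = Fin.castAdd z (Fin.castAdd y i) := rfl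

@[simp] theorem finCongr_natAdd_castAdd {x y z : ℕ} (h : x + (y + z) = x + y + z) (i : Fin y) :
    Fin.cast h (Fin.natAdd x (Fin.castAdd z i)) = Fin.castAdd z (Fin.natAdd x i) := rfl

@[simp] theorem finCongr_natAdd_natAdd {x y z : ℕ} (h : x + (y + z) = x + y + z) (i : Fin z) :
    Fin.cast h (Fin.natAdd x (Fin.natAdd y i)) = Fin.natAdd (x + y) i :=
  Fin.ext (Nat.add_assoc x y i).symm

@[simp] theorem finCongr_castAdd_castAdd {x y z : ℕ} (h : x + y + z = x + (y + z)) (i : Fin x) :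
    Fin.cast h (Fin.castAdd z (Fin.castAdd y i)) = Fin.castAdd (y + z) i := rfl

@[simp] theorem finCongr_castAdd_natAdd {x y z : ℕ} (h : x + y + z = x + (y + z)) (i : Fin y) :
    Fin.cast h (Fin.castAdd z (Fin.natAdd x i)) = Fin.natAdd x (Fin.castAdd z i) := rfl

@[simp] theorem finCongr_natAdd {x y z : ℕ} (h : x + y + z = x + (y + z)) (i : Fin z) :
    Fin.cast h (Fin.natAdd (x + y) i) = Fin.natAdd x (Fin.natAdd y i) :=
  Fin.ext (Nat.add_assoc x y i)

theorem tensor_assoc {a a' b b' c c' : ℕ} (M : Net S a a') (N : Net S b b') (K : Net S c c') :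
    Isomorphic
      ((tensor (tensor M N) K).reindex (Equiv.refl _) (finCongr (Nat.add_assoc a' b' c').symm))
      ((tensor M (tensor N K)).reindex (finCongr (Nat.add_assoc a b c)) (Equiv.refl _)) := by
  refine ⟨⟨Equiv.sumAssoc _ _ _, Equiv.sumAssoc _ _ _, ?_, ?_, ?_, ?_, ?_⟩,
    Equiv.bijective _, Equiv.bijective _⟩
  · rintro ((x | x) | x) <;> rfl
  · rintro ((x | x) | x) i <;> rfl
  · intro k
    induction k using Fin.addCases with
    | left k => simp [reindex]; rfl
    | right k => induction k using Fin.addCases <;> simp [reindex] <;> rfl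
  · rintro ((x | x) | x) i <;> rfl
  · intro k
    induction k using Fin.addCases with
    | left k => induction k using Fin.addCases <;> simp [reindex] <;> rfl
    | right k => simp [reindex]; rfl

theorem id_tensor {a a' : ℕ} (M : Net S a a') :
    Isomorphic ((tensor (Net.id 0) M).reindex (Equiv.refl _) (finCongr (Nat.zero_add a').symm))
      (M.reindex (finCongr (Nat.zero_add a)) (Equiv.refl _)) := by
  refine ⟨⟨Sum.elim (fun i : Fin 0 => i.elim0) id, Sum.elim (fun x : Empty => x.elim) id,
    ?_, ?_, ?_, ?_, ?_⟩, ⟨?_, fun p => ⟨Sum.inr p, rfl⟩⟩, ?_, fun p => ⟨Sum.inr p, rfl⟩⟩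
  · rintro (x | x)
    · exact Empty.elim x
    · rfl
  · rintro (x | x) i
    · exact Empty.elim x
    · rfl
  · intro k
    have : Fin.cast (Nat.zero_add a').symm k = Fin.natAdd 0 k := Fin.ext (by simp)
    simp only [reindex, Function.comp, finCongr_apply, this, tensor_out_right]
    rfl
  · rintro (x | x) i
    · exact Empty.elim x
    · rfl
  · intro k
    induction k using Fin.addCases with
    | left k => exact k.elim0
    | right k =>
      have : Fin.cast (Nat.zero_add a) (Fin.natAdd 0 k) = k := Fin.ext (by simp)
      simp only [reindex, Function.comp, finCongr_apply, Equiv.refl_apply, tensor_inp_right]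
      exact congrArg M.inp this.symm
  · rintro (p | p) (q | q) h
    · exact Fin.elim0 p
    · exact Fin.elim0 p
    · exact Fin.elim0 q
    · exact congrArg Sum.inr h
  · rintro (p | p) (q | q) h
    · exact Empty.elim p
    · exact Empty.elim p
    · exact Empty.elim q
    · exact congrArg Sum.inr h

theorem tensor_id {a a' : ℕ} (M : Net S a a') :
    Isomorphic ((tensor M (Net.id 0)).reindex (Equiv.refl _) (finCongr (Nat.add_zero a').symm))
      (M.reindex (finCongr (Nat.add_zero a)) (Equiv.refl _)) := by
  refine ⟨⟨Sum.elim id (fun i : Fin 0 => i.elim0), Sum.elim id (fun x : Empty => x.elim),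
    ?_, ?_, ?_, ?_, ?_⟩, ⟨?_, fun p => ⟨Sum.inl p, rfl⟩⟩, ?_, fun p => ⟨Sum.inl p, rfl⟩⟩
  · rintro (x | x)
    · rfl
    · exact Empty.elim x
  · rintro (x | x) i
    · rfl
    · exact Empty.elim x
  · intro k
    have : Fin.cast (Nat.add_zero a').symm k = Fin.castAdd 0 k := Fin.ext (by simp)
    simp only [reindex, Function.comp, finCongr_apply, this, tensor_out_left]
    rfl
  · rintro (x | x) i
    · rfl
    · exact Empty.elim x
  · intro k
    induction k using Fin.addCases with
    | right k => exact k.elim0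
    | left k =>
      simp only [reindex, Function.comp, Equiv.refl_apply, tensor_inp_left]
      rfl
  · rintro (p | p) (q | q) h
    · exact congrArg Sum.inl h
    · exact Fin.elim0 q
    · exact Fin.elim0 p
    · exact Fin.elim0 p
  · rintro (p | p) (q | q) h
    · exact congrArg Sum.inl h
    · exact Empty.elim q
    · exact Empty.elim p
    · exact Empty.elim p

theorem tensor_braid {a a' b b' : ℕ} (M : Net S a a') (N : Net S b b') :
    Isomorphic ((tensor M N).reindex (Equiv.refl _) finAddFlip)
      ((tensor N M).reindex (finAddFlip (m := b) (n := a)).symm (Equiv.refl _)) := by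
  refine ⟨⟨Equiv.sumComm _ _, Equiv.sumComm _ _, ?_, ?_, ?_, ?_, ?_⟩,
    Equiv.bijective _, Equiv.bijective _⟩
  · rintro (x | x) <;> rfl
  · rintro (x | x) i <;> rfl
  · intro k
    induction k using Fin.addCases <;> simp [reindex] <;> rfl
  · rintro (x | x) i <;> rfl
  · intro k
    have : (finAddFlip (m := b) (n := a)).symm = finAddFlip := by
      ext k; rfl
    induction k using Fin.addCases <;> simp [reindex, this] <;> rfl

/-! ### Sharing and erasing -/

/-- `N'` is obtained from `N` by sharing: there are operators `x`, `y` of `N` with the same label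
and the same inputs, and `N'` is the quotient of `N` (with quotient morphism `φ`) by the smallest
equivalence relations identifying the outputs of `x` with those of `y`, respectively `x` with
`y`. -/
def IsSharing {m n : ℕ} (N N' : Net S m n) : Prop :=
  ∃ (x y : N.Op) (h : N.label x = N.label y),
    (∀ i, N.opSrc x i = N.opSrc y (Fin.cast (congrArg S.arity h) i)) ∧
    ∃ φ : Mor N N', Function.Surjective φ.onPort ∧ Function.Surjective φ.onOp ∧
      (∀ p q, φ.onPort p = φ.onPort q ↔ Relation.EqvGen (fun p q => ∃ i,
        p = N.opTgt x i ∧ q = N.opTgt y (Fin.cast (congrArg S.coarity h) i)) p q) ∧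
      (∀ a b, φ.onOp a = φ.onOp b ↔ Relation.EqvGen (fun a b => a = x ∧ b = y) a b)

/-- `N'` is obtained from `N` by erasing: there is an operator `x` of `N` none of whose outputs is
a source, and `N'` is the subnet of `N` (with inclusion `φ`) consisting of all operators
except `x` and of all ports except the outputs of `x`. -/
def IsErasing {m n : ℕ} (N N' : Net S m n) : Prop :=
  ∃ x : N.Op, (∀ i, (∀ y j, N.opSrc y j ≠ N.opTgt x i) ∧ ∀ k, N.out k ≠ N.opTgt x i) ∧
    ∃ φ : Mor N' N, Function.Injective φ.onPort ∧ Function.Injective φ.onOp ∧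
      (∀ p, (∃ p', φ.onPort p' = p) ↔ ∀ i, p ≠ N.opTgt x i) ∧
      (∀ y, (∃ y', φ.onOp y' = y) ↔ y ≠ x)

/-- The se-rewriting relation on nets. -/
def SERewrites {m n : ℕ} (N N' : Net S m n) : Prop := IsSharing N N' ∨ IsErasing N N'

theorem kernel_of_section {α β : Type} {r : α → α → Prop} {f : α → β}
    (h : ∀ p q, r p q → f p = f q) (g : β → Quot r) (hg : ∀ p, g (f p) = Quot.mk r p) (p q : α) :
    f p = f q ↔ Relation.EqvGen r p q := by
  refine ⟨fun e => Quot.eqvGen_exact (by rw [← hg, ← hg, e]), fun e => ?_⟩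
  exact congrArg (Quot.lift f h) (Quot.eqvGen_sound e)

theorem exists_section {α β : Type} {r : α → α → Prop} {f : α → β} (hf : Function.Surjective f)
    (h : ∀ p q, f p = f q ↔ Relation.EqvGen r p q) :
    ∃ g : β → Quot r, ∀ p, g (f p) = Quot.mk r p :=
  ⟨fun b => Quot.mk r (hf b).choose,
    fun p => Quot.eqvGen_sound ((h _ _).1 (hf (f p)).choose_spec)⟩

theorem IsSharing.comp_left {n₁ n₂ n₃ : ℕ} {M M' : Net S n₁ n₂} (h : IsSharing M M')
    (N : Net S n₂ n₃) : IsSharing (comp M N) (comp M' N) := by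
  obtain ⟨x, y, hl, hs, φ, h1, h2, h3, h4⟩ := h
  obtain ⟨g, hg⟩ := exists_section h1 h3
  obtain ⟨gO, hgO⟩ := exists_section h2 h4
  refine ⟨Sum.inl x, Sum.inl y, hl, fun i => congrArg (fun p => Quot.mk _ (Sum.inl p)) (hs i),
    compMap φ (Mor.refl N), compMap_surjective _ _ h1 Function.surjective_id,
    h2.sumMap Function.surjective_id, ?_, ?_⟩
  · refine kernel_of_section ?_ (Quot.lift (Sum.elim (fun p => Quot.map
      (fun p => Quot.mk (compRel M N) (Sum.inl p)) ?_ (g p))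
      (fun q => Quot.mk _ (Quot.mk _ (Sum.inr q)))) ?_) ?_
    · rintro _ _ ⟨i, rfl, rfl⟩
      exact congrArg (fun p => Quot.mk _ (Sum.inl p)) ((h3 _ _).2 (.rel _ _ ⟨i, rfl, rfl⟩))
    · rintro _ _ ⟨i, rfl, rfl⟩
      exact ⟨i, rfl, rfl⟩
    · rintro _ _ ⟨k, rfl, rfl⟩
      simp only [Sum.elim_inl, Sum.elim_inr, ← φ.out_eq, hg]
      exact congrArg (Quot.mk _) (comp_sound M N k)
    · intro c
      induction c using Quot.ind with
      | mk c =>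
        rcases c with p | q
        · exact congrArg (Quot.map _ fun _ _ ⟨i, e, e'⟩ =>
            ⟨i, congrArg (fun p => Quot.mk _ (Sum.inl p)) e,
              congrArg (fun p => Quot.mk _ (Sum.inl p)) e'⟩) (hg p)
        · rfl
  · refine kernel_of_section ?_ (Sum.elim (fun a => Quot.map Sum.inl ?_ (gO a))
      (fun b => Quot.mk _ (Sum.inr b))) ?_
    · rintro _ _ ⟨rfl, rfl⟩
      exact congrArg Sum.inl ((h4 _ _).2 (.rel _ _ ⟨rfl, rfl⟩))
    · rintro _ _ ⟨rfl, rfl⟩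
      exact ⟨rfl, rfl⟩
    · rintro (a | b)
      · exact congrArg (Quot.map _ fun _ _ e =>
        ⟨congrArg Sum.inl e.1, congrArg Sum.inl e.2⟩) (hgO a)
      · rfl

theorem IsSharing.comp_right {n₁ n₂ n₃ : ℕ} (M : Net S n₁ n₂) {N N' : Net S n₂ n₃}
    (h : IsSharing N N') : IsSharing (comp M N) (comp M N') := by
  obtain ⟨x, y, hl, hs, φ, h1, h2, h3, h4⟩ := h
  obtain ⟨g, hg⟩ := exists_section h1 h3
  obtain ⟨gO, hgO⟩ := exists_section h2 h4
  refine ⟨Sum.inr x, Sum.inr y, hl, fun i => congrArg (fun p => Quot.mk _ (Sum.inr p)) (hs i),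
    compMap (Mor.refl M) φ, compMap_surjective _ _ Function.surjective_id h1,
    Function.surjective_id.sumMap h2, ?_, ?_⟩
  · refine kernel_of_section ?_ (Quot.lift (Sum.elim (fun q => Quot.mk _ (Quot.mk _ (Sum.inl q)))
      (fun p => Quot.map (fun p => Quot.mk (compRel M N) (Sum.inr p)) ?_ (g p))) ?_) ?_
    · rintro _ _ ⟨i, rfl, rfl⟩
      exact congrArg (fun p => Quot.mk _ (Sum.inr p)) ((h3 _ _).2 (.rel _ _ ⟨i, rfl, rfl⟩))
    · rintro _ _ ⟨i, rfl, rfl⟩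
      exact ⟨i, rfl, rfl⟩
    · rintro _ _ ⟨k, rfl, rfl⟩
      simp only [Sum.elim_inl, Sum.elim_inr, ← φ.inp_eq, hg]
      exact congrArg (Quot.mk _) (comp_sound M N k)
    · intro c
      induction c using Quot.ind with
      | mk c =>
        rcases c with p | q
        · rfl
        · exact congrArg (Quot.map _ fun _ _ ⟨i, e, e'⟩ =>
            ⟨i, congrArg (fun p => Quot.mk _ (Sum.inr p)) e,
              congrArg (fun p => Quot.mk _ (Sum.inr p)) e'⟩) (hg q)
  · refine kernel_of_section ?_ (Sum.elim (fun b => Quot.mk _ (Sum.inl b))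
      (fun a => Quot.map Sum.inr ?_ (gO a))) ?_
    · rintro _ _ ⟨rfl, rfl⟩
      exact congrArg Sum.inr ((h4 _ _).2 (.rel _ _ ⟨rfl, rfl⟩))
    · rintro _ _ ⟨rfl, rfl⟩
      exact ⟨rfl, rfl⟩
    · rintro (a | b)
      · rfl
      · exact congrArg (Quot.map _ fun _ _ e =>
        ⟨congrArg Sum.inr e.1, congrArg Sum.inr e.2⟩) (hgO b)

theorem IsSharing.tensor_left {m m' n n' : ℕ} {M M' : Net S m m'} (h : IsSharing M M')
    (N : Net S n n') : IsSharing (tensor M N) (tensor M' N) := by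
  obtain ⟨x, y, hl, hs, φ, h1, h2, h3, h4⟩ := h
  obtain ⟨g, hg⟩ := exists_section h1 h3
  obtain ⟨gO, hgO⟩ := exists_section h2 h4
  refine ⟨Sum.inl x, Sum.inl y, hl, fun i => congrArg Sum.inl (hs i),
    tensorMap φ (Mor.refl N), h1.sumMap Function.surjective_id,
    h2.sumMap Function.surjective_id, ?_, ?_⟩
  · refine kernel_of_section ?_ (Sum.elim (fun p => Quot.map Sum.inl ?_ (g p))
      (fun q => Quot.mk _ (Sum.inr q))) ?_
    · rintro _ _ ⟨i, rfl, rfl⟩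
      exact congrArg Sum.inl ((h3 _ _).2 (.rel _ _ ⟨i, rfl, rfl⟩))
    · rintro _ _ ⟨i, rfl, rfl⟩
      exact ⟨i, rfl, rfl⟩
    · rintro (p | q)
      · exact congrArg (Quot.map _ fun _ _ ⟨i, e, e'⟩ =>
            ⟨i, congrArg Sum.inl e, congrArg Sum.inl e'⟩) (hg p)
      · rfl
  · refine kernel_of_section ?_ (Sum.elim (fun a => Quot.map Sum.inl ?_ (gO a))
      (fun b => Quot.mk _ (Sum.inr b))) ?_
    · rintro _ _ ⟨rfl, rfl⟩
      exact congrArg Sum.inl ((h4 _ _).2 (.rel _ _ ⟨rfl, rfl⟩))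
    · rintro _ _ ⟨rfl, rfl⟩
      exact ⟨rfl, rfl⟩
    · rintro (a | b)
      · exact congrArg (Quot.map _ fun _ _ e =>
        ⟨congrArg Sum.inl e.1, congrArg Sum.inl e.2⟩) (hgO a)
      · rfl

theorem IsErasing.comp_left {n₁ n₂ n₃ : ℕ} {M M' : Net S n₁ n₂} (h : IsErasing M M')
    (N : Net S n₂ n₃) : IsErasing (comp M N) (comp M' N) := by
  obtain ⟨x, hx, φ, h1, h2, h3, h4⟩ := h
  have key : ∀ i q, Quot.mk (compRel M N) (Sum.inr q) ≠ Quot.mk _ (Sum.inl (M.opTgt x i)) := by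
    intro i q e
    obtain ⟨k, hk, -⟩ := comp_inl_eq_inr M N e.symm
    exact (hx i).2 k hk
  refine ⟨Sum.inl x, fun i => ⟨?_, fun k => key i _⟩, compMap φ (Mor.refl N),
    compMap_injective _ _ h1 Function.injective_id, h2.sumMap Function.injective_id, ?_, ?_⟩
  · rintro (y | y) j e
    · exact (hx i).1 y j (comp_inl_inj M N e)
    · exact key i _ e
  · intro c
    constructor
    · rintro ⟨c', rfl⟩ i e
      induction c' using Quot.ind with
      | mk c' =>
        rcases c' with p | q
        · exact (h3 _).1 ⟨p, rfl⟩ i (comp_inl_inj M N e)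
        · exact key i _ e
    · intro hc
      induction c using Quot.ind with
      | mk c =>
        rcases c with p | q
        · obtain ⟨p', rfl⟩ := (h3 p).2 fun i e =>
            hc i (congrArg (fun p => Quot.mk _ (Sum.inl p)) e)
          exact ⟨Quot.mk _ (Sum.inl p'), rfl⟩
        · exact ⟨Quot.mk _ (Sum.inr q), rfl⟩
  · rintro (y | y)
    · refine ⟨?_, fun hy => ?_⟩
      · rintro ⟨y' | y', e⟩ e'
        · exact (h4 y).1 ⟨y', Sum.inl_injective e⟩ (Sum.inl_injective e')
        · cases e
      · obtain ⟨y', hy'⟩ := (h4 y).2 fun e => hy (congrArg Sum.inl e)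
        exact ⟨Sum.inl y', congrArg Sum.inl hy'⟩
    · exact ⟨fun _ => Sum.inr_ne_inl, fun _ => ⟨Sum.inr y, rfl⟩⟩

theorem IsErasing.comp_right {n₁ n₂ n₃ : ℕ} (M : Net S n₁ n₂) {N N' : Net S n₂ n₃}
    (h : IsErasing N N') : IsErasing (comp M N) (comp M N') := by
  obtain ⟨x, hx, φ, h1, h2, h3, h4⟩ := h
  have hi : ∀ i k, N.inp k ≠ N.opTgt x i := fun i k => (N.opTgt_ne_inp x i k).symm
  have key : ∀ i p, Quot.mk (compRel M N) (Sum.inl p) ≠ Quot.mk _ (Sum.inr (N.opTgt x i)) := by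
    intro i p e
    obtain ⟨k, -, hk⟩ := comp_inl_eq_inr M N e
    exact hi i k hk
  have key2 : ∀ i q, q ≠ N.opTgt x i →
      Quot.mk (compRel M N) (Sum.inr q) ≠ Quot.mk _ (Sum.inr (N.opTgt x i)) := by
    intro i q hq e
    by_cases h : ∃ k, N.inp k = q
    · obtain ⟨k, rfl⟩ := h
      exact key i _ ((comp_sound M N k).trans e)
    · exact hq (comp_inr_inj M N (fun k hk => h ⟨k, hk⟩) (hi i) e)
  refine ⟨Sum.inr x, fun i => ⟨?_, fun k => key2 i _ ((hx i).2 k)⟩, compMap (Mor.refl M) φ,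
    compMap_injective _ _ Function.injective_id h1, Function.injective_id.sumMap h2, ?_, ?_⟩
  · rintro (y | y) j
    · exact key i _
    · exact key2 i _ ((hx i).1 y j)
  · intro c
    constructor
    · rintro ⟨c', rfl⟩ i
      induction c' using Quot.ind with
      | mk c' =>
        rcases c' with p | q
        · exact key i _
        · exact key2 i _ ((h3 _).1 ⟨q, rfl⟩ i)
    · intro hc
      induction c using Quot.ind with
      | mk c =>
        rcases c with p | q
        · exact ⟨Quot.mk _ (Sum.inl p), rfl⟩
        · obtain ⟨q', rfl⟩ := (h3 q).2 fun i e =>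
            hc i (congrArg (fun p => Quot.mk _ (Sum.inr p)) e)
          exact ⟨Quot.mk _ (Sum.inr q'), rfl⟩
  · rintro (y | y)
    · exact ⟨fun _ => Sum.inl_ne_inr, fun _ => ⟨Sum.inl y, rfl⟩⟩
    · refine ⟨?_, fun hy => ?_⟩
      · rintro ⟨y' | y', e⟩ e'
        · cases e
        · exact (h4 y).1 ⟨y', Sum.inr_injective e⟩ (Sum.inr_injective e')
      · obtain ⟨y', hy'⟩ := (h4 y).2 fun e => hy (congrArg Sum.inr e)
        exact ⟨Sum.inr y', congrArg Sum.inr hy'⟩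

theorem IsErasing.tensor_left {m m' n n' : ℕ} {M M' : Net S m m'} (h : IsErasing M M')
    (N : Net S n n') : IsErasing (tensor M N) (tensor M' N) := by
  obtain ⟨x, hx, φ, h1, h2, h3, h4⟩ := h
  refine ⟨Sum.inl x, fun i => ⟨?_, fun k => ?_⟩, tensorMap φ (Mor.refl N),
    h1.sumMap Function.injective_id, h2.sumMap Function.injective_id, ?_, ?_⟩
  · rintro (y | y) j e
    · exact (hx i).1 y j (Sum.inl_injective e)
    · exact Sum.inr_ne_inl e
  · induction k using Fin.addCases with
    | left k =>
      rw [tensor_out_left]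
      exact fun e => (hx i).2 k (Sum.inl_injective e)
    | right k =>
      rw [tensor_out_right]
      exact Sum.inr_ne_inl
  · rintro (p | q)
    · refine ⟨?_, fun hp => ?_⟩
      · rintro ⟨p' | p', e⟩ i e'
        · exact (h3 p).1 ⟨p', Sum.inl_injective e⟩ i (Sum.inl_injective e')
        · cases e
      · obtain ⟨p', hp'⟩ := (h3 p).2 fun i e => hp i (congrArg Sum.inl e)
        exact ⟨Sum.inl p', congrArg Sum.inl hp'⟩
    · exact ⟨fun _ _ => Sum.inr_ne_inl, fun _ => ⟨Sum.inr q, rfl⟩⟩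
  · rintro (y | y)
    · refine ⟨?_, fun hy => ?_⟩
      · rintro ⟨y' | y', e⟩ e'
        · exact (h4 y).1 ⟨y', Sum.inl_injective e⟩ (Sum.inl_injective e')
        · cases e
      · obtain ⟨y', hy'⟩ := (h4 y).2 fun e => hy (congrArg Sum.inl e)
        exact ⟨Sum.inl y', congrArg Sum.inl hy'⟩
    · exact ⟨fun _ => Sum.inr_ne_inl, fun _ => ⟨Sum.inr y, rfl⟩⟩

theorem SERewrites.comp_left {n₁ n₂ n₃ : ℕ} {M M' : Net S n₁ n₂} (h : SERewrites M M')
    (N : Net S n₂ n₃) : SERewrites (comp M N) (comp M' N) :=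
  h.imp (fun h => h.comp_left N) (fun h => h.comp_left N)

theorem SERewrites.comp_right {n₁ n₂ n₃ : ℕ} (M : Net S n₁ n₂) {N N' : Net S n₂ n₃}
    (h : SERewrites N N') : SERewrites (comp M N) (comp M N') :=
  h.imp (fun h => h.comp_right M) (fun h => h.comp_right M)

theorem SERewrites.tensor_left {m m' n n' : ℕ} {M M' : Net S m m'} (h : SERewrites M M')
    (N : Net S n n') : SERewrites (tensor M N) (tensor M' N) :=
  h.imp (fun h => h.tensor_left N) (fun h => h.tensor_left N)

end Net

/-! ### The category of nets -/

/-- Isomorphism classes of nets from `m` to `n`. -/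
def NetHom (S : Signature.{u}) (m n : ℕ) : Type (max u 1) := Quotient (Net.isoSetoid S m n)

namespace NetHom

variable {S : Signature.{u}}

/-- The isomorphism class of a net. -/
def mk {m n : ℕ} (N : Net S m n) : NetHom S m n := Quotient.mk (Net.isoSetoid S m n) N

theorem sound {m n : ℕ} {M N : Net S m n} (h : Net.Isomorphic M N) : mk M = mk N :=
  Quotient.sound (s := Net.isoSetoid S m n) h

theorem ind {m n : ℕ} {p : NetHom S m n → Prop} (h : ∀ N, p (mk N)) (f : NetHom S m n) : p f :=
  Quotient.ind (s := Net.isoSetoid S m n) h f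

/-- Composition of isomorphism classes of nets. -/
def comp {n₁ n₂ n₃ : ℕ} (f : NetHom S n₁ n₂) (g : NetHom S n₂ n₃) : NetHom S n₁ n₃ :=
  Quotient.map₂ (sa := Net.isoSetoid S n₁ n₂) (sb := Net.isoSetoid S n₂ n₃)
    (sc := Net.isoSetoid S n₁ n₃) Net.comp (fun _ _ h _ _ h' => Net.comp_congr h h') f g

/-- Tensor product of isomorphism classes of nets. -/
def tensor {m m' n n' : ℕ} (f : NetHom S m m') (g : NetHom S n n') :
    NetHom S (m + n) (m' + n') :=
  Quotient.map₂ (sa := Net.isoSetoid S m m') (sb := Net.isoSetoid S n n')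
    (sc := Net.isoSetoid S (m + n) (m' + n')) Net.tensor
    (fun _ _ h _ _ h' => Net.tensor_congr h h') f g

/-- The isomorphism class of a net given by a bijection. -/
def perm {m n : ℕ} (e : Fin n ≃ Fin m) : NetHom S m n := mk (Net.perm e)

theorem comp_perm {m n n' : ℕ} (N : Net S m n) (f : Fin n' ≃ Fin n) :
    comp (mk N) (perm f) = mk (N.reindex (Equiv.refl _) f) := (sound (N.comp_perm f)).symm

theorem perm_comp {m n n' : ℕ} (e : Fin n ≃ Fin m) (N : Net S n n') :
    comp (perm e) (mk N) = mk (N.reindex e.symm (Equiv.refl _)) := (sound (N.perm_comp e)).symm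

theorem perm_comp_perm {m n n' : ℕ} (e : Fin n ≃ Fin m) (f : Fin n' ≃ Fin n) :
    comp (perm e : NetHom S m n) (perm f) = perm (f.trans e) := comp_perm _ _

theorem tensor_perm {m n m' n' : ℕ} (e : Fin n ≃ Fin m) (f : Fin n' ≃ Fin m') :
    tensor (perm e : NetHom S m n) (perm f) = perm (Net.permAdd e f) :=
  sound (Net.tensor_perm e f)

/-- The se-rewriting relation on isomorphism classes of nets. -/
def SERewrites {m n : ℕ} (f g : NetHom S m n) : Prop :=
  ∃ M N : Net S m n, mk M = f ∧ mk N = g ∧ Net.SERewrites M N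

theorem SERewrites.comp_left {n₁ n₂ n₃ : ℕ} {f f' : NetHom S n₁ n₂} (h : SERewrites f f')
    (g : NetHom S n₂ n₃) : SERewrites (comp f g) (comp f' g) := by
  obtain ⟨M, M', rfl, rfl, h⟩ := h
  induction g using ind with
  | h N => exact ⟨_, _, rfl, rfl, h.comp_left N⟩

theorem SERewrites.comp_right {n₁ n₂ n₃ : ℕ} (f : NetHom S n₁ n₂) {g g' : NetHom S n₂ n₃}
    (h : SERewrites g g') : SERewrites (comp f g) (comp f g') := by
  obtain ⟨N, N', rfl, rfl, h⟩ := h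
  induction f using ind with
  | h M => exact ⟨_, _, rfl, rfl, h.comp_right M⟩

theorem SERewrites.tensor_left {m m' n n' : ℕ} {f f' : NetHom S m m'} (h : SERewrites f f')
    (g : NetHom S n n') : SERewrites (tensor f g) (tensor f' g) := by
  obtain ⟨M, M', rfl, rfl, h⟩ := h
  induction g using ind with
  | h N => exact ⟨_, _, rfl, rfl, h.tensor_left N⟩

theorem tensor_comp_braid {m m' n n' : ℕ} (f : NetHom S m m') (g : NetHom S n n') :
    comp (tensor f g) (perm finAddFlip) = comp (perm finAddFlip) (tensor g f) := by
  induction f using ind with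
  | h M =>
    induction g using ind with
    | h N => exact (comp_perm _ _).trans ((sound (Net.tensor_braid M N)).trans
        (perm_comp finAddFlip (Net.tensor N M)).symm)

theorem assoc {n₁ n₂ n₃ n₄ : ℕ} (f : NetHom S n₁ n₂) (g : NetHom S n₂ n₃) (h : NetHom S n₃ n₄) :
    comp (comp f g) h = comp f (comp g h) := by
  induction f using ind with
  | h M =>
    induction g using ind with
    | h N =>
      induction h using ind with
      | h K => exact sound (Net.comp_assoc M N K)

theorem id_comp {m n : ℕ} (f : NetHom S m n) : comp (mk (Net.id m)) f = f := by
  induction f using ind with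
  | h N => exact perm_comp _ _

theorem comp_id {m n : ℕ} (f : NetHom S m n) : comp f (mk (Net.id n)) = f := by
  induction f using ind with
  | h N => exact comp_perm _ _

theorem tensor_eq_braid {m m' n n' : ℕ} (f : NetHom S m m') (g : NetHom S n n') :
    tensor f g = comp (perm finAddFlip) (comp (tensor g f) (perm finAddFlip)) := by
  rw [← assoc, ← tensor_comp_braid, assoc, perm_comp_perm]
  refine ((comp_id _).symm.trans ?_)
  congr 2
  exact congrArg Net.perm (by
    ext k
    induction k using Fin.addCases <;> simp)

theorem SERewrites.tensor_right {m m' n n' : ℕ} (f : NetHom S m m') {g g' : NetHom S n n'}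
    (h : SERewrites g g') : SERewrites (tensor f g) (tensor f g') := by
  rw [tensor_eq_braid f g, tensor_eq_braid f g']
  exact ((h.tensor_left f).comp_left _).comp_right _

theorem tensor_comp {a₁ a₂ a₃ b₁ b₂ b₃ : ℕ} (f : NetHom S a₁ a₂) (g : NetHom S a₂ a₃)
    (f' : NetHom S b₁ b₂) (g' : NetHom S b₂ b₃) :
    comp (tensor f f') (tensor g g') = tensor (comp f g) (comp f' g') := by
  induction f using ind with
  | h M =>
    induction g using ind with
    | h N =>
      induction f' using ind with
      | h M' =>
        induction g' using ind with
        | h N' => exact sound (Net.tensor_comp M N M' N')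

theorem id_tensor_id (m n : ℕ) :
    tensor (mk (Net.id m)) (mk (Net.id n)) = (mk (Net.id (m + n)) : NetHom S _ _) := by
  refine (tensor_perm _ _).trans (congrArg perm ?_)
  ext k
  induction k using Fin.addCases <;> simp

theorem tensor_assoc {a a' b b' c c' : ℕ} (f : NetHom S a a') (g : NetHom S b b')
    (h : NetHom S c c') :
    comp (tensor (tensor f g) h) (perm (finCongr (Nat.add_assoc a' b' c').symm)) =
      comp (perm (finCongr (Nat.add_assoc a b c).symm)) (tensor f (tensor g h)) := by
  induction f using ind with
  | h M =>
    induction g using ind with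
    | h N =>
      induction h using ind with
      | h K => exact (comp_perm _ _).trans ((sound (Net.tensor_assoc M N K)).trans
          (perm_comp (finCongr (Nat.add_assoc a b c).symm) (Net.tensor M (Net.tensor N K))).symm)

theorem id_tensor {a a' : ℕ} (f : NetHom S a a') :
    comp (tensor (mk (Net.id 0)) f) (perm (finCongr (Nat.zero_add a').symm)) =
      comp (perm (finCongr (Nat.zero_add a).symm)) f := by
  induction f using ind with
  | h M => exact (comp_perm _ _).trans ((sound (Net.id_tensor M)).trans (perm_comp (finCongr (Nat.zero_add a).symm) M).symm)

theorem tensor_id {a a' : ℕ} (f : NetHom S a a') :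
    comp (tensor f (mk (Net.id 0))) (perm (finCongr (Nat.add_zero a').symm)) =
      comp (perm (finCongr (Nat.add_zero a).symm)) f := by
  induction f using ind with
  | h M => exact (comp_perm _ _).trans ((sound (Net.tensor_id M)).trans (perm_comp (finCongr (Nat.add_zero a).symm) M).symm)

theorem pentagon (w x y z : ℕ) :
    comp (tensor (perm (finCongr (Nat.add_assoc w x y).symm)) (mk (Net.id z)))
      (comp (perm (finCongr (Nat.add_assoc w (x + y) z).symm))
        (tensor (mk (Net.id w)) (perm (finCongr (Nat.add_assoc x y z).symm)))) =
    (comp (perm (finCongr (Nat.add_assoc (w + x) y z).symm))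
      (perm (finCongr (Nat.add_assoc w x (y + z)).symm)) : NetHom S _ _) := by
  have h : ∀ n, (mk (Net.id n) : NetHom S n n) = perm (finCongr rfl) := fun _ => rfl
  simp only [h, tensor_perm, perm_comp_perm, Net.permAdd_finCongr]
  rfl

theorem triangle (x y : ℕ) :
    comp (perm (finCongr (Nat.add_assoc x 0 y).symm))
      (tensor (mk (Net.id x)) (perm (finCongr (Nat.zero_add y).symm))) =
    (tensor (perm (finCongr (Nat.add_zero x).symm)) (mk (Net.id y)) : NetHom S _ _) := by
  have h : ∀ n, (mk (Net.id n) : NetHom S n n) = perm (finCongr rfl) := fun _ => rfl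
  simp only [h, tensor_perm, perm_comp_perm, Net.permAdd_finCongr]
  rfl

theorem hexagon_forward (x y z : ℕ) :
    comp (perm (finCongr (Nat.add_assoc x y z).symm))
      (comp (perm (finAddFlip (m := y + z) (n := x)))
        (perm (finCongr (Nat.add_assoc y z x).symm))) =
    (comp (tensor (perm (finAddFlip (m := y) (n := x))) (mk (Net.id z)))
      (comp (perm (finCongr (Nat.add_assoc y x z).symm))
        (tensor (mk (Net.id y)) (perm (finAddFlip (m := z) (n := x))))) : NetHom S _ _) := by
  have h : ∀ n, (mk (Net.id n) : NetHom S n n) = perm (Equiv.refl _) := fun _ => rfl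
  simp only [h, tensor_perm, perm_comp_perm]
  refine congrArg perm (Equiv.ext fun k => ?_)
  induction k using Fin.addCases with
  | left k => simp
  | right k => induction k using Fin.addCases <;> simp

theorem hexagon_reverse (x y z : ℕ) :
    comp (perm (finCongr (Nat.add_assoc x y z)))
      (comp (perm (finAddFlip (m := z) (n := x + y)))
        (perm (finCongr (Nat.add_assoc z x y)))) =
    (comp (tensor (mk (Net.id x)) (perm (finAddFlip (m := z) (n := y))))
      (comp (perm (finCongr (Nat.add_assoc x z y)))
        (tensor (perm (finAddFlip (m := z) (n := x))) (mk (Net.id y)))) : NetHom S _ _) := by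
  have h : ∀ n, (mk (Net.id n) : NetHom S n n) = perm (Equiv.refl _) := fun _ => rfl
  simp only [h, tensor_perm, perm_comp_perm]
  refine congrArg perm (Equiv.ext fun k => ?_)
  induction k using Fin.addCases with
  | left k => induction k using Fin.addCases <;> simp
  | right k => simp

theorem braid_braid (x y : ℕ) :
    comp (perm (finAddFlip (m := y) (n := x))) (perm (finAddFlip (m := x) (n := y))) =
      (mk (Net.id (x + y)) : NetHom S _ _) := by
  refine (perm_comp_perm _ _).trans (congrArg perm (Equiv.ext fun k => ?_))
  induction k using Fin.addCases <;> simp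

end NetHom

/-- The category `Net_S`: objects are natural numbers, morphisms are isomorphism classes of
nets. -/
structure NetCat (S : Signature.{u}) where
  size : ℕ

namespace NetCat

variable {S : Signature.{u}}

instance : Category.{max u 1} (NetCat S) where
  Hom X Y := NetHom S X.size Y.size
  id X := NetHom.mk (Net.id X.size)
  comp f g := NetHom.comp f g
  id_comp f := NetHom.id_comp f
  comp_id f := NetHom.comp_id f
  assoc f g h := NetHom.assoc f g h

/-- The morphism of `Net_S` given by a net. -/
def ofNet {m n : ℕ} (N : Net S m n) : (⟨m⟩ : NetCat S) ⟶ ⟨n⟩ := NetHom.mk N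

/-- The isomorphism of `Net_S` given by a bijection. -/
def permIso {X Y : NetCat S} (e : Fin Y.size ≃ Fin X.size) : X ≅ Y where
  hom := NetHom.perm e
  inv := NetHom.perm e.symm
  hom_inv_id := (NetHom.perm_comp_perm _ _).trans (congrArg NetHom.perm e.symm_trans_self)
  inv_hom_id := (NetHom.perm_comp_perm _ _).trans (congrArg NetHom.perm e.self_trans_symm)

instance : MonoidalCategoryStruct (NetCat S) where
  tensorObj X Y := ⟨X.size + Y.size⟩
  tensorUnit := ⟨0⟩
  tensorHom f g := NetHom.tensor f g
  whiskerLeft X _ _ f := NetHom.tensor (NetHom.mk (Net.id X.size)) f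
  whiskerRight f Y := NetHom.tensor f (NetHom.mk (Net.id Y.size))
  associator X Y Z := permIso (finCongr (Nat.add_assoc X.size Y.size Z.size).symm)
  leftUnitor X := permIso (finCongr (Nat.zero_add X.size).symm)
  rightUnitor X := permIso (finCongr (Nat.add_zero X.size).symm)

instance : MonoidalCategory (NetCat S) := .ofTensorHom
  (id_tensorHom_id := fun X Y => NetHom.id_tensor_id X.size Y.size)
  (id_tensorHom := fun _ _ _ _ => rfl)
  (tensorHom_id := fun _ _ => rfl)
  (tensorHom_comp_tensorHom := fun f f' g g' => NetHom.tensor_comp f g f' g')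
  (associator_naturality := fun f g h => NetHom.tensor_assoc f g h)
  (leftUnitor_naturality := fun f => NetHom.id_tensor f)
  (rightUnitor_naturality := fun f => NetHom.tensor_id f)
  (pentagon := fun W X Y Z => NetHom.pentagon W.size X.size Y.size Z.size)
  (triangle := fun X Y => NetHom.triangle X.size Y.size)

instance : SymmetricCategory (NetCat S) where
  braiding X Y := permIso (X := X ⊗ Y) (Y := Y ⊗ X) (finAddFlip (m := Y.size) (n := X.size))
  braiding_naturality_right _ _ _ f := NetHom.tensor_comp_braid _ f
  braiding_naturality_left f _ := NetHom.tensor_comp_braid f _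
  hexagon_forward X Y Z := NetHom.hexagon_forward X.size Y.size Z.size
  hexagon_reverse X Y Z := NetHom.hexagon_reverse X.size Y.size Z.size
  symmetry X Y := NetHom.braid_braid X.size Y.size

end NetCat

/-! ### The category of nets up to se-equivalence -/

/-- Isomorphism classes of nets modulo se-equivalence, the equivalence relation generated by
se-rewriting. -/
def SNetHom (S : Signature.{u}) (m n : ℕ) : Type (max u 1) :=
  Quot (NetHom.SERewrites : NetHom S m n → NetHom S m n → Prop)

namespace SNetHom

variable {S : Signature.{u}}

/-- The class modulo se-equivalence. -/
def mk {m n : ℕ} (f : NetHom S m n) : SNetHom S m n := Quot.mk _ f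

theorem ind {m n : ℕ} {p : SNetHom S m n → Prop} (h : ∀ f, p (mk f)) (f : SNetHom S m n) : p f :=
  Quot.ind h f

/-- Composition modulo se-equivalence. -/
def comp {n₁ n₂ n₃ : ℕ} (f : SNetHom S n₁ n₂) (g : SNetHom S n₂ n₃) : SNetHom S n₁ n₃ :=
  Quot.map₂ NetHom.comp (fun f _ _ h => h.comp_right f) (fun _ _ g h => h.comp_left g) f g

/-- Tensor product modulo se-equivalence. -/
def tensor {m m' n n' : ℕ} (f : SNetHom S m m') (g : SNetHom S n n') :
    SNetHom S (m + n) (m' + n') :=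
  Quot.map₂ NetHom.tensor (fun f _ _ h => h.tensor_right f) (fun _ _ g h => h.tensor_left g) f g

end SNetHom

/-- The category `sNet_S`: objects are natural numbers, morphisms are nets up to isomorphism and
se-equivalence. -/
structure SNetCat (S : Signature.{u}) where
  size : ℕ

namespace SNetCat

variable {S : Signature.{u}}

instance : Category.{max u 1} (SNetCat S) where
  Hom X Y := SNetHom S X.size Y.size
  id X := SNetHom.mk (NetHom.mk (Net.id X.size))
  comp f g := SNetHom.comp f g
  id_comp f := by
    induction f using SNetHom.ind with
    | h f => exact congrArg SNetHom.mk (NetHom.id_comp f)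
  comp_id f := by
    induction f using SNetHom.ind with
    | h f => exact congrArg SNetHom.mk (NetHom.comp_id f)
  assoc f g h := by
    induction f using SNetHom.ind with
    | h f =>
      induction g using SNetHom.ind with
      | h g =>
        induction h using SNetHom.ind with
        | h h => exact congrArg SNetHom.mk (NetHom.assoc f g h)

/-- The morphism of `sNet_S` given by a net. -/
def ofNet {m n : ℕ} (N : Net S m n) : (⟨m⟩ : SNetCat S) ⟶ ⟨n⟩ := SNetHom.mk (NetHom.mk N)

/-- The isomorphism of `sNet_S` given by a bijection. -/
def permIso {X Y : SNetCat S} (e : Fin Y.size ≃ Fin X.size) : X ≅ Y where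
  hom := SNetHom.mk (NetHom.perm e)
  inv := SNetHom.mk (NetHom.perm e.symm)
  hom_inv_id := congrArg SNetHom.mk
    ((NetHom.perm_comp_perm _ _).trans (congrArg NetHom.perm e.symm_trans_self))
  inv_hom_id := congrArg SNetHom.mk
    ((NetHom.perm_comp_perm _ _).trans (congrArg NetHom.perm e.self_trans_symm))

instance : MonoidalCategoryStruct (SNetCat S) where
  tensorObj X Y := ⟨X.size + Y.size⟩
  tensorUnit := ⟨0⟩
  tensorHom f g := SNetHom.tensor f g
  whiskerLeft X _ _ f := SNetHom.tensor (SNetHom.mk (NetHom.mk (Net.id X.size))) f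
  whiskerRight f Y := SNetHom.tensor f (SNetHom.mk (NetHom.mk (Net.id Y.size)))
  associator X Y Z := permIso (finCongr (Nat.add_assoc X.size Y.size Z.size).symm)
  leftUnitor X := permIso (finCongr (Nat.zero_add X.size).symm)
  rightUnitor X := permIso (finCongr (Nat.add_zero X.size).symm)

instance : MonoidalCategory (SNetCat S) := .ofTensorHom
  (id_tensorHom_id := fun X Y => congrArg SNetHom.mk (NetHom.id_tensor_id X.size Y.size))
  (id_tensorHom := fun _ _ _ _ => rfl)
  (tensorHom_id := fun _ _ => rfl)
  (tensorHom_comp_tensorHom := fun f f' g g' => by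
    induction f using SNetHom.ind with
    | h f =>
      induction g using SNetHom.ind with
      | h g =>
        induction f' using SNetHom.ind with
        | h f' =>
          induction g' using SNetHom.ind with
          | h g' => exact congrArg SNetHom.mk (NetHom.tensor_comp f g f' g'))
  (associator_naturality := fun f g h => by
    induction f using SNetHom.ind with
    | h f =>
      induction g using SNetHom.ind with
      | h g =>
        induction h using SNetHom.ind with
        | h h => exact congrArg SNetHom.mk (NetHom.tensor_assoc f g h))
  (leftUnitor_naturality := fun f => by
    induction f using SNetHom.ind with
    | h f => exact congrArg SNetHom.mk (NetHom.id_tensor f))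
  (rightUnitor_naturality := fun f => by
    induction f using SNetHom.ind with
    | h f => exact congrArg SNetHom.mk (NetHom.tensor_id f))
  (pentagon := fun W X Y Z =>
    congrArg SNetHom.mk (NetHom.pentagon W.size X.size Y.size Z.size))
  (triangle := fun X Y => congrArg SNetHom.mk (NetHom.triangle X.size Y.size))

instance : SymmetricCategory (SNetCat S) where
  braiding X Y := permIso (X := X ⊗ Y) (Y := Y ⊗ X) (finAddFlip (m := Y.size) (n := X.size))
  braiding_naturality_right _ _ _ f := by
    induction f using SNetHom.ind with
    | h f => exact congrArg SNetHom.mk (NetHom.tensor_comp_braid _ f)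
  braiding_naturality_left f _ := by
    induction f using SNetHom.ind with
    | h f => exact congrArg SNetHom.mk (NetHom.tensor_comp_braid f _)
  hexagon_forward X Y Z :=
    congrArg SNetHom.mk (NetHom.hexagon_forward X.size Y.size Z.size)
  hexagon_reverse X Y Z :=
    congrArg SNetHom.mk (NetHom.hexagon_reverse X.size Y.size Z.size)
  symmetry X Y := congrArg SNetHom.mk (NetHom.braid_braid X.size Y.size)

end SNetCat

/-! ### Traces -/

/-- A trace on a symmetric monoidal category: a family of functions natural in `A` and `B`,
dinatural in `X`, satisfying vanishing, superposing and yanking.  The associators and unitors are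
written out. -/
structure Trace (C : Type w) [Category.{v} C] [MonoidalCategory C] [SymmetricCategory C] where
  tr : ∀ A B X : C, (A ⊗ X ⟶ B ⊗ X) → (A ⟶ B)
  naturality_left : ∀ {A A' B X : C} (g : A' ⟶ A) (f : A ⊗ X ⟶ B ⊗ X),
    tr A' B X (g ▷ X ≫ f) = g ≫ tr A B X f
  naturality_right : ∀ {A B B' X : C} (f : A ⊗ X ⟶ B ⊗ X) (g : B ⟶ B'),
    tr A B' X (f ≫ g ▷ X) = tr A B X f ≫ g
  /-- (Di)naturality in `X`, also called sliding. -/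
  sliding : ∀ {A B X Y : C} (f : A ⊗ X ⟶ B ⊗ Y) (g : Y ⟶ X),
    tr A B X (f ≫ B ◁ g) = tr A B Y (A ◁ g ≫ f)
  vanishing_unit : ∀ {A B : C} (f : A ⊗ 𝟙_ C ⟶ B ⊗ 𝟙_ C),
    tr A B (𝟙_ C) f = (ρ_ A).inv ≫ f ≫ (ρ_ B).hom
  vanishing_tensor : ∀ {A B X Y : C} (f : (A ⊗ X) ⊗ Y ⟶ (B ⊗ X) ⊗ Y),
    tr A B (X ⊗ Y) ((α_ A X Y).inv ≫ f ≫ (α_ B X Y).hom) =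
      tr A B X (tr (A ⊗ X) (B ⊗ X) Y f)
  superposing : ∀ {A B C' D X : C} (f : A ⊗ X ⟶ B ⊗ X) (g : C' ⟶ D),
    g ⊗ₘ tr A B X f =
      tr (C' ⊗ A) (D ⊗ B) X ((α_ C' A X).hom ≫ (g ⊗ₘ f) ≫ (α_ D B X).inv)
  yanking : ∀ X : C, tr X X X (β_ X X).hom = 𝟙 X

end ProcessNet

namespace ProcessNet

namespace Net

variable {S : Signature.{u}}

/-! ### Traces of nets and isomorphisms -/

/-! All the constructions are gluings: a composite glues the outputs of one net to the inputs of the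
next, and a trace glues the last outputs of a net to its own last inputs. The two sides of each
trace axiom have the same operators, up to the empty operator sets of identity nets and the order of
summands. Their ports arise from the same gluings, performed in another order or routed through
wires that get absorbed. So each axiom for nets (`trace_comp_left`, `trace_comp_right`,
`trace_slide`, `trace_zero`, `trace_trace`, `tensor_trace`, `trace_braid`) is proved by an explicit
isomorphism. Its map on ports is lifted through the quotients, the conditions for lifting being the
gluings of the other side, and its inverse is built in the same way.

These isomorphisms become equations between isomorphism classes once the trace respects isomorphism
(`trace_congr`). The point there is that a morphism injective on ports stays injective after gluing
(`traceMap_injective`): the glued ports of the target net all lie in the image, and their gluings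
already hold in the trace of the source net.

For the category modulo se-equivalence, the trace must also respect one rewriting step. Sharing is
itself a quotient of ports, and the two quotients commute (`IsSharing.trace`). In an erasing, the
removed ports are not glued to anything, being neither sources nor targets of inputs of the net
(`IsErasing.trace`). The axioms then descend to se-classes by choosing representatives. -/

theorem trace_sound {n₁ n₂ n : ℕ} (N : Net S (n₁ + n) (n₂ + n)) (k : Fin n) :
    Quot.mk (traceRel N) (N.out (Fin.natAdd n₂ k)) =
      Quot.mk (traceRel N) (N.inp (Fin.natAdd n₁ k)) :=
  Quot.sound ⟨k, rfl, rfl⟩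

/-- The trace of nets is functorial with respect to morphisms of nets. -/
def traceMap {n₁ n₂ n : ℕ} {M N : Net S (n₁ + n) (n₂ + n)} (φ : Mor M N) :
    Mor (trace M) (trace N) where
  onPort := Quot.map φ.onPort <| by
    rintro _ _ ⟨k, rfl, rfl⟩
    exact ⟨k, φ.out_eq _, φ.inp_eq _⟩
  onOp := φ.onOp
  label_eq := φ.label_eq
  opSrc_eq x i := congrArg (Quot.mk _) (φ.opSrc_eq x i)
  out_eq k := congrArg (Quot.mk _) (φ.out_eq _)
  opTgt_eq x i := congrArg (Quot.mk _) (φ.opTgt_eq x i)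
  inp_eq k := congrArg (Quot.mk _) (φ.inp_eq _)

theorem traceMap_surjective {n₁ n₂ n : ℕ} {M N : Net S (n₁ + n) (n₂ + n)} (φ : Mor M N)
    (hφ : Function.Surjective φ.onPort) : Function.Surjective (traceMap φ).onPort := by
  rintro ⟨c⟩
  obtain ⟨d, rfl⟩ := hφ c
  exact ⟨Quot.mk _ d, rfl⟩

/-- A morphism of nets which is injective on ports remains so after taking the trace. -/
theorem traceMap_injective {n₁ n₂ n : ℕ} {M N : Net S (n₁ + n) (n₂ + n)} (φ : Mor M N)
    (hφ : Function.Injective φ.onPort) : Function.Injective (traceMap φ).onPort := by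
  classical
  -- A partial left inverse of the induced map: a port in the image of `φ` goes to the class of its
  -- preimage, any other port to `none`. It respects `traceRel N` because both glued ports are
  -- images under `φ` of ports that are already glued in the trace of `M`.
  let g : Quot (traceRel N) → Option (Quot (traceRel M)) := Quot.lift
    (fun p => if h : ∃ p', φ.onPort p' = p then some (Quot.mk _ h.choose) else none) <| by
      rintro _ _ ⟨k, rfl, rfl⟩
      have h₁ : ∃ p', φ.onPort p' = N.out (Fin.natAdd n₂ k) := ⟨_, φ.out_eq _⟩
      have h₂ : ∃ p', φ.onPort p' = N.inp (Fin.natAdd n₁ k) := ⟨_, φ.inp_eq _⟩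
      rw [dif_pos h₁, dif_pos h₂, hφ (h₁.choose_spec.trans (φ.out_eq _).symm),
        hφ (h₂.choose_spec.trans (φ.inp_eq _).symm)]
      exact congrArg some (trace_sound M k)
  have hg : ∀ c, g ((traceMap φ).onPort c) = some c := by
    rintro ⟨p⟩
    have h : ∃ p', φ.onPort p' = φ.onPort p := ⟨p, rfl⟩
    exact (dif_pos h).trans (congrArg (fun q => some (Quot.mk _ q)) (hφ h.choose_spec))
  intro c d h
  exact Option.some_injective _ ((hg c).symm.trans ((congrArg g h).trans (hg d)))

theorem trace_congr {n₁ n₂ n : ℕ} {M N : Net S (n₁ + n) (n₂ + n)} (h : Isomorphic M N) :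
    Isomorphic (trace M) (trace N) := by
  obtain ⟨φ, hφ, hφ'⟩ := h
  exact ⟨traceMap φ, ⟨traceMap_injective φ hφ.1, traceMap_surjective φ hφ.2⟩, hφ'⟩

/-! ### The trace axioms for nets -/

/-- Naturality in the domain. On the left, each feedback loop passes through a wire of `Net.id n`;
this wire is already glued to one of the last inputs of `F`, so it contributes no new port. -/
theorem trace_comp_left {a' a b n : ℕ} (G : Net S a' a) (F : Net S (a + n) (b + n)) :
    Isomorphic (trace (comp (tensor G (Net.id n)) F)) (comp G (trace F)) := by
  refine ⟨⟨Quot.lift (Quot.lift (Sum.elim (Sum.elim (fun p => Quot.mk _ (Sum.inl p))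
      (fun k => Quot.mk _ (Sum.inr (Quot.mk _ (F.inp (Fin.natAdd a k))))))
      (fun q => Quot.mk _ (Sum.inr (Quot.mk _ q)))) ?_) ?_,
    (Equiv.sumEmpty _ Empty).sumCongr (Equiv.refl _), ?_, ?_, ?_, ?_, ?_⟩,
    Function.bijective_iff_has_inverse.2 ⟨Quot.lift (Sum.elim
      (fun p => Quot.mk _ (Quot.mk _ (Sum.inl (Sum.inl p))))
      (Quot.lift (fun q => Quot.mk _ (Quot.mk _ (Sum.inr q))) ?_)) ?_, ?_, ?_⟩,
    Equiv.bijective _⟩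
  · rintro _ _ ⟨k, rfl, rfl⟩
    induction k using Fin.addCases with
    | left k =>
      rw [tensor_out_left]
      exact comp_sound G (trace F) k
    | right k =>
      rw [tensor_out_right]
      rfl
  · rintro _ _ ⟨k, rfl, rfl⟩
    simp only [comp, tensor_inp_right]
    exact congrArg (fun p => Quot.mk _ (Sum.inr p)) (trace_sound F k)
  · rintro ((x | x) | x)
    · rfl
    · exact Empty.elim x
    · rfl
  · rintro ((x | x) | x) i
    · rfl
    · exact Empty.elim x
    · rfl
  · exact fun _ => rfl
  · rintro ((x | x) | x) i
    · rfl
    · exact Empty.elim x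
    · rfl
  · intro k
    simp only [comp, trace, tensor_inp_left]
    rfl
  · rintro _ _ ⟨k, rfl, rfl⟩
    -- The loop is closed in two stages: `h`, from the trace, joins a last output of `F` to the
    -- identity wire, and `h'`, from the composite, joins this wire to the corresponding last input
    -- of `F`.
    have h := trace_sound (comp (tensor G (Net.id n)) F) k
    have h' := comp_sound (tensor G (Net.id n)) F (Fin.natAdd a k)
    simp only [comp, tensor_inp_right] at h
    rw [tensor_out_right] at h'
    exact h.trans (congrArg (Quot.mk _) h')
  · rintro _ _ ⟨k, rfl, rfl⟩
    have h' := comp_sound (tensor G (Net.id n)) F (Fin.castAdd n k)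
    rw [tensor_out_left] at h'
    exact congrArg (Quot.mk _) h'
  · rintro ⟨⟨(p | (k : Fin n)) | q⟩⟩
    · rfl
    · have h' := comp_sound (tensor G (Net.id n)) F (Fin.natAdd a k)
      rw [tensor_out_right] at h'
      exact congrArg (Quot.mk _) h'.symm
    · rfl
  · rintro ⟨p | (⟨q⟩ : Quot (traceRel F))⟩ <;> rfl

/-- Mirror image of `trace_comp_left`: here the identity wires are absorbed into the last outputs of
`F`. -/
theorem trace_comp_right {a b b' n : ℕ} (F : Net S (a + n) (b + n)) (G : Net S b b') :
    Isomorphic (trace (comp F (tensor G (Net.id n)))) (comp (trace F) G) := by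
  refine ⟨⟨Quot.lift (Quot.lift (Sum.elim (fun q => Quot.mk _ (Sum.inl (Quot.mk _ q)))
      (Sum.elim (fun p => Quot.mk _ (Sum.inr p))
      (fun k => Quot.mk _ (Sum.inl (Quot.mk _ (F.out (Fin.natAdd b k))))))) ?_) ?_,
    (Equiv.refl _).sumCongr (Equiv.sumEmpty _ Empty), ?_, ?_, ?_, ?_, ?_⟩,
    Function.bijective_iff_has_inverse.2 ⟨Quot.lift (Sum.elim
      (Quot.lift (fun q => Quot.mk _ (Quot.mk _ (Sum.inl q))) ?_)
      (fun p => Quot.mk _ (Quot.mk _ (Sum.inr (Sum.inl p))))) ?_, ?_, ?_⟩,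
    Equiv.bijective _⟩
  · rintro _ _ ⟨k, rfl, rfl⟩
    induction k using Fin.addCases with
    | left k =>
      rw [tensor_inp_left]
      exact comp_sound (trace F) G k
    | right k =>
      rw [tensor_inp_right]
      rfl
  · rintro _ _ ⟨k, rfl, rfl⟩
    simp only [comp, tensor_out_right]
    exact congrArg (fun p => Quot.mk _ (Sum.inl p)) (trace_sound F k)
  · rintro (x | (x | x))
    · rfl
    · rfl
    · exact Empty.elim x
  · rintro (x | (x | x)) i
    · rfl
    · rfl
    · exact Empty.elim x
  · intro k
    simp only [comp, trace, tensor_out_left]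
    rfl
  · rintro (x | (x | x)) i
    · rfl
    · rfl
    · exact Empty.elim x
  · exact fun _ => rfl
  · rintro _ _ ⟨k, rfl, rfl⟩
    have h := trace_sound (comp F (tensor G (Net.id n))) k
    have h' := comp_sound F (tensor G (Net.id n)) (Fin.natAdd b k)
    simp only [comp, tensor_out_right] at h
    rw [tensor_inp_right] at h'
    exact (congrArg (Quot.mk _) h').trans h
  · rintro _ _ ⟨k, rfl, rfl⟩
    have h' := comp_sound F (tensor G (Net.id n)) (Fin.castAdd n k)
    rw [tensor_inp_left] at h'
    exact congrArg (Quot.mk _) h'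
  · rintro ⟨⟨q | (p | (k : Fin n))⟩⟩
    · rfl
    · rfl
    · have h' := comp_sound F (tensor G (Net.id n)) (Fin.natAdd b k)
      rw [tensor_inp_right] at h'
      exact congrArg (Quot.mk _) h'
  · rintro ⟨(⟨q⟩ : Quot (traceRel F)) | p⟩ <;> rfl

/-- Both sides arrange `F` and `G` in a ring, the last outputs of `F` feeding `G` and the outputs of
`G` feeding the last inputs of `F`. They differ only in which of the two gluings is due to the
composite and which to the trace. -/
theorem trace_slide {a b x y : ℕ} (F : Net S (a + x) (b + y)) (G : Net S y x) :
    Isomorphic (trace (comp F (tensor (Net.id b) G))) (trace (comp (tensor (Net.id a) G) F)) := by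
  -- The gluings of the left-hand net (`hl`, `hr`, `ht`) and of the right-hand net (primed). `hl`
  -- and `hl'` absorb identity wires. The composite provides `hr` and `hr'`, the trace `ht` and
  -- `ht'`; `hr` corresponds to `ht'`, and `ht` to `hr'`.
  have hl : ∀ k : Fin b, Quot.mk (compRel F (tensor (Net.id b) G))
      (Sum.inl (F.out (Fin.castAdd y k))) = Quot.mk _ (Sum.inr (Sum.inl k)) := fun k => by
    have h := comp_sound F (tensor (Net.id b) G) (Fin.castAdd y k)
    rwa [tensor_inp_left] at h
  have hr : ∀ k : Fin y, Quot.mk (compRel F (tensor (Net.id b) G))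
      (Sum.inl (F.out (Fin.natAdd b k))) = Quot.mk _ (Sum.inr (Sum.inr (G.inp k))) := fun k => by
    have h := comp_sound F (tensor (Net.id b) G) (Fin.natAdd b k)
    rwa [tensor_inp_right] at h
  have ht : ∀ k : Fin x, Quot.mk (traceRel (comp F (tensor (Net.id b) G)))
      (Quot.mk _ (Sum.inr (Sum.inr (G.out k)))) =
      Quot.mk _ (Quot.mk _ (Sum.inl (F.inp (Fin.natAdd a k)))) := fun k => by
    have h := trace_sound (comp F (tensor (Net.id b) G)) k
    simp only [comp, tensor_out_right] at h
    exact h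
  have hl' : ∀ k : Fin a, Quot.mk (compRel (tensor (Net.id a) G) F) (Sum.inl (Sum.inl k)) =
      Quot.mk _ (Sum.inr (F.inp (Fin.castAdd x k))) := fun k => by
    have h := comp_sound (tensor (Net.id a) G) F (Fin.castAdd x k)
    rwa [tensor_out_left] at h
  have hr' : ∀ k : Fin x, Quot.mk (compRel (tensor (Net.id a) G) F) (Sum.inl (Sum.inr (G.out k))) =
      Quot.mk _ (Sum.inr (F.inp (Fin.natAdd a k))) := fun k => by
    have h := comp_sound (tensor (Net.id a) G) F (Fin.natAdd a k)
    rwa [tensor_out_right] at h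
  have ht' : ∀ k : Fin y, Quot.mk (traceRel (comp (tensor (Net.id a) G) F))
      (Quot.mk _ (Sum.inr (F.out (Fin.natAdd b k)))) =
      Quot.mk _ (Quot.mk _ (Sum.inl (Sum.inr (G.inp k)))) := fun k => by
    have h := trace_sound (comp (tensor (Net.id a) G) F) k
    simp only [comp, tensor_inp_right] at h
    exact h
  -- Ports of `F` and of `G` go to themselves. The identity wires on `b` exist only on the left and
  -- go to the first outputs of `F`; in the inverse, those on `a` go to the first inputs of `F`.
  refine ⟨⟨Quot.lift (Quot.lift (Sum.elim (fun p => Quot.mk _ (Quot.mk _ (Sum.inr p)))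
      (Sum.elim (fun k => Quot.mk _ (Quot.mk _ (Sum.inr (F.out (Fin.castAdd y k)))))
        (fun q => Quot.mk _ (Quot.mk _ (Sum.inl (Sum.inr q)))))) ?_) ?_,
    Equiv.trans ((Equiv.refl _).sumCongr (Equiv.emptySum Empty _))
      ((Equiv.sumComm _ _).trans ((Equiv.emptySum Empty _).symm.sumCongr (Equiv.refl _))),
      ?_, ?_, ?_, ?_, ?_⟩,
    Function.bijective_iff_has_inverse.2 ⟨Quot.lift (Quot.lift (Sum.elim
      (Sum.elim (fun k => Quot.mk _ (Quot.mk _ (Sum.inl (F.inp (Fin.castAdd x k)))))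
        (fun q => Quot.mk _ (Quot.mk _ (Sum.inr (Sum.inr q)))))
      (fun p => Quot.mk _ (Quot.mk _ (Sum.inl p)))) ?_) ?_, ?_, ?_⟩,
    Equiv.bijective _⟩
  · rintro _ _ ⟨k, rfl, rfl⟩
    induction k using Fin.addCases with
    | left k =>
      rw [tensor_inp_left]
      rfl
    | right k =>
      rw [tensor_inp_right]
      exact ht' k
  · rintro _ _ ⟨k, rfl, rfl⟩
    simp only [comp, tensor_out_right]
    exact congrArg (Quot.mk _) (hr' k)
  · rintro (z | (z | z))
    · rfl
    · exact Empty.elim z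
    · rfl
  · rintro (z | (z | z)) i
    · rfl
    · exact Empty.elim z
    · rfl
  · intro k
    simp only [comp, trace, tensor_out_left]
    rfl
  · rintro (z | (z | z)) i
    · rfl
    · exact Empty.elim z
    · rfl
  · intro k
    simp only [comp, trace, tensor_inp_left]
    exact congrArg (Quot.mk _) (hl' k).symm
  · rintro _ _ ⟨k, rfl, rfl⟩
    induction k using Fin.addCases with
    | left k =>
      rw [tensor_out_left]
      rfl
    | right k =>
      rw [tensor_out_right]
      exact ht k
  · rintro _ _ ⟨k, rfl, rfl⟩
    simp only [comp, tensor_inp_right]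
    exact congrArg (Quot.mk _) (hr k)
  · rintro ⟨⟨p | (k | q)⟩⟩
    · rfl
    · exact congrArg (Quot.mk _) (hl k)
    · rfl
  · rintro ⟨⟨(k | q) | p⟩⟩
    · exact congrArg (Quot.mk _) (hl' k).symm
    · rfl
    · rfl

/-- With no feedback wire, the gluing relation is empty. -/
theorem trace_zero {a b : ℕ} (F : Net S (a + 0) (b + 0)) : Isomorphic (trace F) F := by
  refine ⟨⟨Quot.lift id ?_, id, fun _ => rfl, fun _ _ => rfl, fun _ => rfl, fun _ _ => rfl,
    fun _ => rfl⟩,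
    Function.bijective_iff_has_inverse.2 ⟨Quot.mk _, by rintro ⟨p⟩; rfl, fun _ => rfl⟩,
    Function.bijective_id⟩
  rintro _ _ ⟨k, -⟩
  exact k.elim0

/-- A quotient taken at once or in two stages: among the `x + y` loops, the last `y` are those of
the inner trace and the first `x` those of the outer one. -/
theorem trace_trace {a b x y : ℕ} (F : Net S (a + x + y) (b + x + y)) :
    Isomorphic (trace (F.reindex (finCongr (Nat.add_assoc a x y).symm)
      (finCongr (Nat.add_assoc b x y).symm))) (trace (trace F)) := by
  refine ⟨⟨Quot.lift (fun p => Quot.mk _ (Quot.mk _ p)) ?_, id, fun _ => rfl, fun _ _ => rfl,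
    fun _ => rfl, fun _ _ => rfl, fun _ => rfl⟩,
    Function.bijective_iff_has_inverse.2 ⟨Quot.lift (Quot.lift (Quot.mk _) ?_) ?_,
      by rintro ⟨p⟩; rfl, by rintro ⟨⟨p⟩⟩; rfl⟩,
    Function.bijective_id⟩
  · rintro _ _ ⟨k, rfl, rfl⟩
    induction k using Fin.addCases with
    | left k => exact trace_sound (trace F) k
    | right k =>
      simp only [reindex, Function.comp, finCongr_apply, finCongr_natAdd_natAdd]
      exact congrArg (Quot.mk _) (trace_sound F k)
  · rintro _ _ ⟨k, rfl, rfl⟩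
    have h := trace_sound (F.reindex (finCongr (Nat.add_assoc a x y).symm)
      (finCongr (Nat.add_assoc b x y).symm)) (Fin.natAdd x k)
    simp only [reindex, Function.comp, finCongr_apply, finCongr_natAdd_natAdd] at h
    exact h
  · rintro _ _ ⟨k, rfl, rfl⟩
    exact trace_sound (F.reindex (finCongr (Nat.add_assoc a x y).symm)
      (finCongr (Nat.add_assoc b x y).symm)) (Fin.castAdd y k)

/-- The last `x` inputs and outputs of the tensor product all belong to `F`, so the gluing leaves
the ports of `G` alone. -/
theorem tensor_trace {a b c d x : ℕ} (F : Net S (a + x) (b + x)) (G : Net S c d) :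
    Isomorphic (tensor G (trace F)) (trace ((tensor G F).reindex
      (finCongr (Nat.add_assoc c a x)) (finCongr (Nat.add_assoc d b x)))) := by
  have ht : ∀ k : Fin x, Quot.mk (traceRel ((tensor G F).reindex
      (finCongr (Nat.add_assoc c a x)) (finCongr (Nat.add_assoc d b x))))
      (Sum.inr (F.out (Fin.natAdd b k))) =
      Quot.mk _ (Sum.inr (F.inp (Fin.natAdd a k))) := fun k => by
    have h := trace_sound ((tensor G F).reindex
      (finCongr (Nat.add_assoc c a x)) (finCongr (Nat.add_assoc d b x))) k
    simp only [reindex, Function.comp, finCongr_apply, finCongr_natAdd, tensor_out_right,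
      tensor_inp_right] at h
    exact h
  refine ⟨⟨Sum.elim (fun p => Quot.mk _ (Sum.inl p)) (Quot.lift (fun q => Quot.mk _ (Sum.inr q))
      ?_), id, fun _ => rfl, ?_, ?_, ?_, ?_⟩,
    Function.bijective_iff_has_inverse.2 ⟨Quot.lift (Sum.map id (Quot.mk _)) ?_, ?_, ?_⟩,
    Function.bijective_id⟩
  · rintro _ _ ⟨k, rfl, rfl⟩
    exact ht k
  · rintro (z | z) i <;> rfl
  · intro k
    induction k using Fin.addCases <;> simp [reindex, trace]
  · rintro (z | z) i <;> rfl
  · intro k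
    induction k using Fin.addCases <;> simp [reindex, trace]
  · rintro _ _ ⟨k, rfl, rfl⟩
    simp only [reindex, Function.comp, finCongr_apply, finCongr_natAdd, tensor_out_right,
      tensor_inp_right]
    exact congrArg Sum.inr (trace_sound F k)
  · rintro (p | (⟨q⟩ : Quot (traceRel F))) <;> rfl
  · rintro ⟨p | q⟩ <;> rfl

/-- The symmetry has `n + n` wires. Its last outputs lie on the first `n` wires, so the trace glues
the `k`-th wire to the `(n + k)`-th, leaving `n` classes. The `k`-th remaining input lies on the
first wire of its class and the `k`-th remaining output on the second. -/
theorem trace_braid (n : ℕ) :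
    Isomorphic (trace (perm (finAddFlip (m := n) (n := n)) : Net S (n + n) (n + n)))
      (Net.id n) := by
  -- `Fin.append id id` folds the two halves of the wires onto each other, and the inverse picks the
  -- wire in the first half.
  refine ⟨⟨Quot.lift (Fin.append id id) ?_, id, ?_, ?_, ?_, ?_, ?_⟩,
    Function.bijective_iff_has_inverse.2 ⟨fun k => Quot.mk _ (Fin.castAdd n k), ?_, ?_⟩,
    Function.bijective_id⟩
  · rintro _ _ ⟨k, rfl, rfl⟩
    simp only [perm, finAddFlip_apply_natAdd]
    exact (Fin.append_left id id k).trans (Fin.append_right id id k).symm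
  · exact fun x => Empty.elim x
  · exact fun x => Empty.elim x
  · intro k
    simp only [trace, perm, Net.id, finAddFlip_apply_castAdd, Fin.append_right]
    rfl
  · exact fun x => Empty.elim x
  · intro k
    simp only [trace, perm, Net.id, Fin.append_left]
    rfl
  · rintro ⟨k : Fin (n + n)⟩
    induction k using Fin.addCases with
    | left k =>
      exact congrArg (fun i => Quot.mk _ (Fin.castAdd n i)) (Fin.append_left id id k)
    | right k =>
      have h := trace_sound
        (perm (finAddFlip (m := n) (n := n)) : Net S (n + n) (n + n)) k
      simp only [perm, finAddFlip_apply_natAdd] at h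
      exact (congrArg (fun i => Quot.mk _ (Fin.castAdd n i)) (Fin.append_right id id k)).trans h
  · intro k
    exact Fin.append_left id id k

/-! ### Traces and se-rewriting -/

/-- Quotients of ports commute: gluing and then sharing identifies the same ports as sharing and
then gluing. The trace does not change operators, so the conditions on them carry over as they are.
-/
theorem IsSharing.trace {n₁ n₂ n : ℕ} {N N' : Net S (n₁ + n) (n₂ + n)} (h : IsSharing N N') :
    IsSharing (trace N) (trace N') := by
  obtain ⟨x, y, hl, hs, φ, h1, h2, h3, h4⟩ := h
  obtain ⟨g, hg⟩ := exists_section h1 h3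
  -- To compute the kernel of the induced map, ports of the trace of `N'` are sent back, by means of
  -- `g`, to ports of the trace of `N` modulo sharing.
  refine ⟨x, y, hl, fun i => congrArg (Quot.mk _) (hs i), traceMap φ, traceMap_surjective φ h1,
    h2, kernel_of_section ?_ (Quot.lift (fun p => Quot.map (Quot.mk (traceRel N)) ?_ (g p)) ?_) ?_,
    h4⟩
  · rintro _ _ ⟨i, rfl, rfl⟩
    exact congrArg (Quot.mk _) ((h3 _ _).2 (.rel _ _ ⟨i, rfl, rfl⟩))
  · rintro _ _ ⟨i, rfl, rfl⟩
    exact ⟨i, rfl, rfl⟩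
  · rintro _ _ ⟨k, rfl, rfl⟩
    -- The ports glued in `N'` are images of ports glued in `N`, on which `g` is known.
    simp only [← φ.out_eq, ← φ.inp_eq, hg]
    exact congrArg (Quot.mk _) (trace_sound N k)
  · rintro ⟨p⟩
    exact congrArg (Quot.map _ fun _ _ ⟨i, e, e'⟩ =>
      ⟨i, congrArg (Quot.mk _) e, congrArg (Quot.mk _) e'⟩) (hg p)

/-- A port which is neither an input nor an output of a net is not identified with any other port
in its trace. -/
theorem traceRel_isolated {n₁ n₂ n : ℕ} (N : Net S (n₁ + n) (n₂ + n)) {p q : N.Port}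
    (hi : ∀ k, N.inp k ≠ p) (ho : ∀ k, N.out k ≠ p)
    (h : Quot.mk (traceRel N) q = Quot.mk (traceRel N) p) : q = p := by
  -- Being equal to `p` is a property invariant under gluing, since `p` lies on neither side of any
  -- gluing; it thus descends to the quotient.
  have := congrArg (Quot.lift (fun r => r = p) fun r r' ⟨k, hr, hr'⟩ => propext
    ⟨fun e => absurd (hr.symm.trans e) (ho _), fun e => absurd (hr'.symm.trans e) (hi _)⟩) h
  exact this.mpr rfl

/-- An output port of the erased operator is not an output of the net by hypothesis, and not an
input by injectivity of the target function. Its class in the trace is therefore a singleton, so it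
is still not a source, and the removed ports are still exactly the outputs of that operator. -/
theorem IsErasing.trace {n₁ n₂ n : ℕ} {N N' : Net S (n₁ + n) (n₂ + n)} (h : IsErasing N N') :
    IsErasing (trace N) (trace N') := by
  obtain ⟨x, hx, φ, h1, h2, h3, h4⟩ := h
  have key : ∀ i q, q ≠ N.opTgt x i →
      Quot.mk (traceRel N) q ≠ Quot.mk (traceRel N) (N.opTgt x i) := fun i q hq e =>
    hq (traceRel_isolated N (fun k => (N.opTgt_ne_inp x i k).symm) (hx i).2 e)
  refine ⟨x, fun i => ⟨fun y j => key i _ ((hx i).1 y j), fun k => key i _ ((hx i).2 _)⟩,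
    traceMap φ, traceMap_injective φ h1, h2, ?_, h4⟩
  rintro ⟨p⟩
  constructor
  · rintro ⟨⟨p'⟩, e⟩ i
    rw [← e]
    exact key i _ ((h3 _).1 ⟨p', rfl⟩ i)
  · intro hp
    obtain ⟨p', rfl⟩ := (h3 p).2 fun i e => hp i (congrArg (Quot.mk _) e)
    exact ⟨Quot.mk _ p', rfl⟩

theorem SERewrites.trace {n₁ n₂ n : ℕ} {N N' : Net S (n₁ + n) (n₂ + n)} (h : SERewrites N N') :
    SERewrites (trace N) (trace N') :=
  h.imp IsSharing.trace IsErasing.trace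

end Net

/-! ### The trace on isomorphism classes and its axioms -/

namespace NetHom

variable {S : Signature.{u}}

/-- The trace of an isomorphism class of nets. -/
def trace {n₁ n₂ n : ℕ} (f : NetHom S (n₁ + n) (n₂ + n)) : NetHom S n₁ n₂ :=
  Quotient.map (sa := Net.isoSetoid S (n₁ + n) (n₂ + n)) (sb := Net.isoSetoid S n₁ n₂)
    Net.trace (fun _ _ h => Net.trace_congr h) f

theorem SERewrites.trace {n₁ n₂ n : ℕ} {f f' : NetHom S (n₁ + n) (n₂ + n)}
    (h : SERewrites f f') : SERewrites (trace f) (trace f') := by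
  obtain ⟨M, M', rfl, rfl, h⟩ := h
  exact ⟨_, _, rfl, rfl, h.trace⟩

theorem trace_comp_left {a' a b n : ℕ} (g : NetHom S a' a) (f : NetHom S (a + n) (b + n)) :
    trace (comp (tensor g (mk (Net.id n))) f) = comp g (trace f) := by
  induction g using ind with
  | h G =>
    induction f using ind with
    | h F => exact sound (Net.trace_comp_left G F)

theorem trace_comp_right {a b b' n : ℕ} (f : NetHom S (a + n) (b + n)) (g : NetHom S b b') :
    trace (comp f (tensor g (mk (Net.id n)))) = comp (trace f) g := by
  induction f using ind with
  | h F =>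
    induction g using ind with
    | h G => exact sound (Net.trace_comp_right F G)

theorem trace_slide {a b x y : ℕ} (f : NetHom S (a + x) (b + y)) (g : NetHom S y x) :
    trace (comp f (tensor (mk (Net.id b)) g)) = trace (comp (tensor (mk (Net.id a)) g) f) := by
  induction f using ind with
  | h F =>
    induction g using ind with
    | h G => exact sound (Net.trace_slide F G)

/-- The bijections here, and in `trace_trace` and `tensor_trace` below, are written exactly as in
the unitors and associators of `NetCat`, so that the axioms of `Trace` follow by unfolding.
Composing with them merely renumbers inputs and outputs, which turns the claim into the one about
nets. -/
theorem trace_zero {a b : ℕ} (f : NetHom S (a + 0) (b + 0)) :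
    trace f = comp (perm (finCongr (Nat.add_zero a).symm).symm)
      (comp f (perm (finCongr (Nat.add_zero b).symm))) := by
  induction f using ind with
  | h F =>
    rw [comp_perm, perm_comp]
    exact sound (Net.trace_zero F)

theorem trace_trace {a b x y : ℕ} (f : NetHom S (a + x + y) (b + x + y)) :
    trace (comp (perm (finCongr (Nat.add_assoc a x y).symm).symm)
      (comp f (perm (finCongr (Nat.add_assoc b x y).symm)))) = trace (trace f) := by
  induction f using ind with
  | h F =>
    rw [comp_perm, perm_comp]
    exact sound (Net.trace_trace F)

theorem tensor_trace {a b c d x : ℕ} (f : NetHom S (a + x) (b + x)) (g : NetHom S c d) :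
    tensor g (trace f) = trace (comp (perm (finCongr (Nat.add_assoc c a x).symm))
      (comp (tensor g f) (perm (finCongr (Nat.add_assoc d b x).symm).symm))) := by
  induction f using ind with
  | h F =>
    induction g using ind with
    | h G =>
      -- The tensor product has to appear as the class of a net for the renumbering lemmas to apply.
      change _ = trace (comp _ (comp (mk (Net.tensor G F)) _))
      rw [comp_perm, perm_comp]
      exact sound (Net.tensor_trace F G)

theorem trace_braid (n : ℕ) :
    trace (perm (finAddFlip (m := n) (n := n)) : NetHom S (n + n) (n + n)) = mk (Net.id n) :=
  sound (Net.trace_braid n)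

end NetHom

/-! ### The two trace structures -/

/-- The trace on `Net_S`. -/
def NetCat.trace (S : Signature.{u}) : Trace (NetCat S) where
  tr _ _ _ f := NetHom.trace f
  naturality_left g f := NetHom.trace_comp_left g f
  naturality_right f g := NetHom.trace_comp_right f g
  sliding f g := NetHom.trace_slide f g
  vanishing_unit f := NetHom.trace_zero f
  vanishing_tensor f := NetHom.trace_trace f
  superposing f g := NetHom.tensor_trace f g
  yanking X := NetHom.trace_braid X.size

/-- The trace of nets modulo se-equivalence. -/
def SNetHom.trace {S : Signature.{u}} {n₁ n₂ n : ℕ} (f : SNetHom S (n₁ + n) (n₂ + n)) :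
    SNetHom S n₁ n₂ :=
  -- Compatibility with a single rewriting step is enough, since the quotient is by the equivalence
  -- relation generated by such steps.
  Quot.map NetHom.trace (fun _ _ h => h.trace) f

/-- The trace on `sNet_S`. -/
def SNetCat.trace (S : Signature.{u}) : Trace (SNetCat S) where
  tr _ _ _ f := SNetHom.trace f
  naturality_left g f := by
    induction g using SNetHom.ind with
    | h g =>
      induction f using SNetHom.ind with
      | h f => exact congrArg SNetHom.mk (NetHom.trace_comp_left g f)
  naturality_right f g := by
    induction f using SNetHom.ind with
    | h f =>
      induction g using SNetHom.ind with
      | h g => exact congrArg SNetHom.mk (NetHom.trace_comp_right f g)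
  sliding f g := by
    induction f using SNetHom.ind with
    | h f =>
      induction g using SNetHom.ind with
      | h g => exact congrArg SNetHom.mk (NetHom.trace_slide f g)
  vanishing_unit f := by
    induction f using SNetHom.ind with
    | h f => exact congrArg SNetHom.mk (NetHom.trace_zero f)
  vanishing_tensor f := by
    induction f using SNetHom.ind with
    | h f => exact congrArg SNetHom.mk (NetHom.trace_trace f)
  superposing f g := by
    induction f using SNetHom.ind with
    | h f =>
      induction g using SNetHom.ind with
      | h g => exact congrArg SNetHom.mk (NetHom.tensor_trace f g)
  yanking X := congrArg SNetHom.mk (NetHom.trace_braid X.size)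

end ProcessNet

theorem mainTheorem2 (S : ProcessNet.Signature.{u}) :
    (∃ T : ProcessNet.Trace (ProcessNet.NetCat S),
      ∀ (n₁ n₂ n : ℕ) (N : ProcessNet.Net S (n₁ + n) (n₂ + n)),
        T.tr ⟨n₁⟩ ⟨n₂⟩ ⟨n⟩ (ProcessNet.NetCat.ofNet N) = ProcessNet.NetCat.ofNet N.trace) ∧
    (∃ T : ProcessNet.Trace (ProcessNet.SNetCat S),
      ∀ (n₁ n₂ n : ℕ) (N : ProcessNet.Net S (n₁ + n) (n₂ + n)),
        T.tr ⟨n₁⟩ ⟨n₂⟩ ⟨n⟩ (ProcessNet.SNetCat.ofNet N) = ProcessNet.SNetCat.ofNet N.trace) :=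
  -- Both traces are induced on quotients by the trace of representatives, so their values on
  -- classes of nets hold by computation.
  ⟨⟨ProcessNet.NetCat.trace S, fun _ _ _ _ => rfl⟩,
    ⟨ProcessNet.SNetCat.trace S, fun _ _ _ _ => rfl⟩⟩
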